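/- Conventions. A 2-complex $Y=(V,E,F)$ consists of vertices, oriented edges and oriented faces, with fixed-point-free inversions $e\mapsto e^{-1}$, $f\mapsto f^{-1}$; every face $f$ has a boundary $\partial f$, a non-empty based cyclically reduced edge loop, with $\partial(f^{-1})=(\partial f)^{-1}$. $|Y^{(1)}|$ and $|Y|$ denote the numbers of geometric edges $\{e,e^{-1}\}$ and geometric faces $\{f,f^{-1}\}$. Let $X_m=\{x_1,\dots,x_m\}$. $Y$ is *fillable* by a set $R$ of words in $X_m^{\pm}$ (or by the presentation $\langle X_m\mid R\rangle$) if there are labelings $\varphi_1:E\to X_m^{\pm}$, $\varphi_2:F\to R\cup R^{-1}$ with $\varphi_1(e^{-1})=\varphi_1(e)^{-1}$, $\varphi_2(f^{-1})=\varphi_2(f)^{-1}$ and $\varphi_1(\partial f)=\varphi_2(f)$ as words, which are reduced: no two distinct faces have the same label and a common edge at the same position of their boundaries. A *geometric form* $(Y,\lambda)$ is a finite connected 2-complex $Y$ without isolated edges (every edge lies on the boundary of a face) with lengths $\lambda_e=\lambda_{e^{-1}}\in(0,1]$ on its edges such that $\sum_{e\in\partial f}\lambda_e\le 1$ (counted with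 multiplicity) for every face $f$. For $\ell$ large enough, let $Y_\ell$ be the 2-complex obtained from $Y$ by dividing every edge $e$ into $\lfloor\lambda_e\ell\rfloor$ edges. Let $m\ge 2$ and let $B_\ell$ be the set of cyclically reduced words of length at most $\ell$ in $X_m^{\pm}$. A sequence of random groups $G_\ell(m,d)=\langle X_m\mid R_\ell\rangle$ with $m$ generators at density $d\in[0,1]$ is given by random subsets $R_\ell\subseteq B_\ell$ such that the law of each $R_\ell$ is invariant under all permutations of $B_\ell$, and $\log_{|B_\ell|}|R_\ell|$ converges to $d$ in probability (with $\log 0=-\infty$). **Statement.** Let $(G_\ell(m,d))$ be a sequence of random groups with $m\ge2$ generators at density $d$, let $(Y,\lambda)$ be a geometric form, with associated sequence $(Y_\ell)$, and let $s>0$. Suppose that, for all sufficiently large $\ell$, $Y_\ell$ is fillable by $B_\ell$ and every sub-2-complex $Z_\ell$ of $Y_\ell$ satisfies $$|Z_\ell^{(1)}|\ \ge\ (1-d+s)\,|Z_\ell|\,\ell .$$ Then asymptotically almost surely $Y_\ell$ is fillable by $G_\ell(m,d)$, i.e. $\Pr(Y_\ell\text{ is fillable by }R_\ell)\to1$ as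 $\ell\to\infty$. -/

import Mathlib

open Filter Topology MeasureTheory

/-- An oriented combinatorial 2-complex: oriented edges and oriented faces come with fixed-point-free
involutions `inv` and `finv`.  The boundary of a face is a based loop, given by its list of oriented
edges; `Cycle.Chain` expresses that cyclically consecutive edges match up and do not backtrack, i.e.
that the list is a cyclically reduced loop. -/
structure TwoComplex (V E F : Type*) where
  src : E → V
  tgt : E → V
  inv : E → E
  src_inv : ∀ e, src (inv e) = tgt e
  tgt_inv : ∀ e, tgt (inv e) = src e
  inv_inv : ∀ e, inv (inv e) = e
  inv_ne : ∀ e, inv e ≠ e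
  finv : F → F
  finv_finv : ∀ f, finv (finv f) = f
  finv_ne : ∀ f, finv f ≠ f
  bdry : F → List E
  bdry_ne_nil : ∀ f, bdry f ≠ []
  bdry_chain : ∀ f, Cycle.Chain (fun e e' => tgt e = src e' ∧ e' ≠ inv e) (bdry f : Cycle E)
  bdry_finv : ∀ f, bdry (finv f) = ((bdry f).map inv).reverse

namespace TwoComplex

variable {V E F : Type*}

/-- Any two vertices are joined by an edge path, and there is at least one vertex. -/
def IsConnected (Y : TwoComplex V E F) : Prop :=
  Nonempty V ∧ ∀ u v : V, Relation.ReflTransGen (fun a b => ∃ e, Y.src e = a ∧ Y.tgt e = b) u v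

/-- Every edge lies on the boundary of some (oriented) face. -/
def NoIsolatedEdges (Y : TwoComplex V E F) : Prop :=
  ∀ e, ∃ f, e ∈ Y.bdry f

/-- A sub-2-complex. -/
structure Sub (Y : TwoComplex V E F) where
  verts : Set V
  edges : Set E
  faces : Set F
  src_mem : ∀ e ∈ edges, Y.src e ∈ verts
  inv_mem : ∀ e ∈ edges, Y.inv e ∈ edges
  finv_mem : ∀ f ∈ faces, Y.finv f ∈ faces
  bdry_mem : ∀ f ∈ faces, ∀ e ∈ Y.bdry f, e ∈ edges

/-- The number of geometric edges (pairs of inverse edges) of a sub-2-complex. -/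
noncomputable def Sub.numEdges {Y : TwoComplex V E F} (Z : Y.Sub) : ℕ :=
  ((fun e => s(e, Y.inv e)) '' Z.edges).ncard

/-- The number of geometric faces (pairs of inverse faces) of a sub-2-complex. -/
noncomputable def Sub.numFaces {Y : TwoComplex V E F} (Z : Y.Sub) : ℕ :=
  ((fun f => s(f, Y.finv f)) '' Z.faces).ncard

/-- A van Kampen 2-complex over the presentation `⟨X | R⟩` with underlying 2-complex `Y`.
Letters of `X^±` are pairs in `X × Bool`, as for Mathlib's free groups; `FreeGroup.invRev` is the
formal inverse of a word. -/
structure VanKampen (Y : TwoComplex V E F) {X : Type*} (R : Set (List (X × Bool))) where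
  edgeLabel : E → X × Bool
  faceLabel : F → List (X × Bool)
  edgeLabel_inv : ∀ e, edgeLabel (Y.inv e) = ((edgeLabel e).1, !(edgeLabel e).2)
  faceLabel_mem : ∀ f, faceLabel f ∈ R ∨ FreeGroup.invRev (faceLabel f) ∈ R
  faceLabel_finv : ∀ f, faceLabel (Y.finv f) = FreeGroup.invRev (faceLabel f)
  compatible : ∀ f, (Y.bdry f).map edgeLabel = faceLabel f

/-- There is no reducible pair of faces, i.e. no two distinct faces with the same label and a common
edge at the same position on their boundaries. -/
def VanKampen.IsReduced {Y : TwoComplex V E F} {X : Type*} {R : Set (List (X × Bool))}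
    (D : Y.VanKampen R) : Prop :=
  ¬ ∃ f f' : F, f ≠ f' ∧ D.faceLabel f = D.faceLabel f' ∧
    ∃ (j : ℕ) (e : E), (Y.bdry f)[j]? = some e ∧ (Y.bdry f')[j]? = some e

/-- `Y` is fillable by the set of relators `R`. -/
def Fillable (Y : TwoComplex V E F) {X : Type*} (R : Set (List (X × Bool))) : Prop :=
  ∃ D : Y.VanKampen R, D.IsReduced

section Subdivision

/-- Oriented edges of the subdivision: the `i`-th segment (`0 ≤ i < n e`) of the oriented edge `e`. -/
abbrev SubdivEdge (n : E → ℕ) : Type _ := {p : E × ℕ // p.2 < n p.1}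

/-- Vertices of the subdivision: the old vertices, and one new vertex for every interior division
point, where the `i`-th division point of `e` is the `(n e - i)`-th one of the inverse of `e`. -/
abbrev SubdivVertex (Y : TwoComplex V E F) (n : E → ℕ) : Type _ :=
  V ⊕ {p : Sym2 (E × ℕ) // ∃ e i, 0 < i ∧ i < n e ∧ p = s((e, i), (Y.inv e, n e - i))}

/-- The `i`-th division point of the edge `e`, for `0 ≤ i ≤ n e`. -/
def subdivPoint (Y : TwoComplex V E F) (n : E → ℕ) (e : E) (i : ℕ) : Y.SubdivVertex n :=
  if h : 0 < i ∧ i < n e then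
    Sum.inr ⟨s((e, i), (Y.inv e, n e - i)), e, i, h.1, h.2, rfl⟩
  else if i = 0 then Sum.inl (Y.src e) else Sum.inl (Y.tgt e)

/-- The edge `e` seen as a path in the subdivision. -/
def subdivArc (n : E → ℕ) (e : E) : List (SubdivEdge n) :=
  (List.finRange (n e)).map fun i : Fin (n e) => ⟨(e, (i : ℕ)), i.2⟩

theorem subdivPoint_inv (Y : TwoComplex V E F) (n : E → ℕ) (hpos : ∀ e, 0 < n e)
    (hinv : ∀ e, n (Y.inv e) = n e) (e : E) (i : ℕ) (hi : i ≤ n e) :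
    Y.subdivPoint n (Y.inv e) (n e - i) = Y.subdivPoint n e i := by
  have h1 := hpos e
  have h2 := hinv e
  unfold subdivPoint
  by_cases h : 0 < i ∧ i < n e
  · have h' : 0 < n e - i ∧ n e - i < n (Y.inv e) := by omega
    rw [dif_pos h, dif_pos h']
    congr 1
    apply Subtype.ext
    simp only
    rw [Y.inv_inv, Sym2.eq_swap, show n (Y.inv e) - (n e - i) = i by omega]
  · have h' : ¬ (0 < n e - i ∧ n e - i < n (Y.inv e)) := by omega
    rw [dif_neg h, dif_neg h']
    by_cases h0 : i = 0
    · rw [if_pos h0, if_neg (by omega), Y.tgt_inv]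
    · rw [if_neg h0, if_pos (by omega), Y.src_inv]

theorem subdivArc_ne_nil (n : E → ℕ) (hpos : ∀ e, 0 < n e) (e : E) : subdivArc n e ≠ [] := by
  intro h
  have := congrArg List.length h
  have := hpos e
  simp [subdivArc] at *
  omega

theorem subdivArc_head (n : E → ℕ) (e : E) (x : SubdivEdge n)
    (hx : x ∈ (subdivArc n e).head?) : x.1.1 = e ∧ x.1.2 = 0 := by
  rw [subdivArc, List.head?_eq_getElem?] at hx
  simp only [List.getElem?_map, Option.mem_def, Option.map_eq_some_iff] at hx
  obtain ⟨i, hi, rfl⟩ := hx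
  rw [List.getElem?_eq_some_iff] at hi
  obtain ⟨h, rfl⟩ := hi
  simp

theorem subdivArc_last (n : E → ℕ) (e : E) (x : SubdivEdge n)
    (hx : x ∈ (subdivArc n e).getLast?) : x.1.1 = e ∧ x.1.2 + 1 = n e := by
  rw [subdivArc, List.getLast?_eq_getElem?] at hx
  simp only [List.getElem?_map, Option.mem_def, Option.map_eq_some_iff] at hx
  obtain ⟨i, hi, rfl⟩ := hx
  rw [List.getElem?_eq_some_iff] at hi
  obtain ⟨h, rfl⟩ := hi
  simp only [List.length_map, List.length_finRange] at h
  simp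
  omega

/-- The boundary paths stay cyclically reduced loops after subdivision. -/
theorem subdiv_chain (Y : TwoComplex V E F) (n : E → ℕ) (hpos : ∀ e, 0 < n e)
    (r : SubdivEdge n → SubdivEdge n → Prop)
    (hr₁ : ∀ x y : SubdivEdge n, x.1.1 = y.1.1 → x.1.2 + 1 = y.1.2 → r x y)
    (hr₂ : ∀ x y : SubdivEdge n, x.1.2 + 1 = n x.1.1 → y.1.2 = 0 →
      Y.tgt x.1.1 = Y.src y.1.1 ∧ y.1.1 ≠ Y.inv x.1.1 → r x y) (f : F) :
    Cycle.Chain r ((Y.bdry f).flatMap (subdivArc n) : Cycle (SubdivEdge n)) := by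
  have key : ∀ l : List E, l.IsChain (fun e e' => Y.tgt e = Y.src e' ∧ e' ≠ Y.inv e) →
      (l.flatMap (subdivArc n)).IsChain r := by
    intro l hl
    rw [List.flatMap, List.isChain_flatten]
    · refine ⟨?_, ?_⟩
      · intro a ha
        obtain ⟨e, -, rfl⟩ := List.mem_map.1 ha
        rw [List.isChain_iff_getElem]
        intro i hi
        apply hr₁ <;> simp [subdivArc]
      · rw [List.isChain_map]
        refine hl.imp ?_
        intro e e' h x hx y hy
        obtain ⟨hx1, hx2⟩ := subdivArc_last n e x hx
        obtain ⟨hy1, hy2⟩ := subdivArc_head n e' y hy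
        exact hr₂ x y (by rw [hx2, hx1]) hy2 (by rw [hx1, hy1]; exact h)
    · intro h
      obtain ⟨e, -, he⟩ := List.mem_map.1 h
      exact subdivArc_ne_nil n hpos e he
  have hc := Y.bdry_chain f
  rcases hb : Y.bdry f with _ | ⟨a, l⟩
  · exact absurd hb (Y.bdry_ne_nil f)
  · rw [hb, Cycle.chain_coe_cons] at hc
    have h := key _ hc
    rcases ha : subdivArc n a with _ | ⟨x, t⟩
    · exact absurd ha (subdivArc_ne_nil n hpos a)
    · simp only [List.flatMap_cons, List.flatMap_append, List.flatMap_nil, ha,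
        List.append_nil, List.cons_append] at h ⊢
      rw [Cycle.chain_coe_cons]
      refine List.IsChain.prefix h ⟨t, ?_⟩
      simp

theorem subdivArc_inv (Y : TwoComplex V E F) (n : E → ℕ)
    (hinv : ∀ e, n (Y.inv e) = n e) (i : SubdivEdge n → SubdivEdge n)
    (hi : ∀ p, (i p).1 = (Y.inv p.1.1, n p.1.1 - 1 - p.1.2)) (e : E) :
    subdivArc n (Y.inv e) = ((subdivArc n e).map i).reverse := by
  apply List.ext_getElem
  · simp [subdivArc, hinv]
  · intro j h1 h2
    apply Subtype.ext
    simp only [subdivArc, List.length_map, List.length_finRange, hinv] at h1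
    simp [subdivArc, hi]
    omega

/-- The 2-complex obtained from `Y` by dividing every edge `e` into `n e ≥ 1` edges. -/
def subdivide (Y : TwoComplex V E F) (n : E → ℕ) (hpos : ∀ e, 0 < n e)
    (hinv : ∀ e, n (Y.inv e) = n e) : TwoComplex (Y.SubdivVertex n) (SubdivEdge n) F where
  src p := Y.subdivPoint n p.1.1 p.1.2
  tgt p := Y.subdivPoint n p.1.1 (p.1.2 + 1)
  inv p := ⟨(Y.inv p.1.1, n p.1.1 - 1 - p.1.2), by
    have := p.2; have := hinv p.1.1; simp only; omega⟩
  src_inv p := by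
    have := Y.subdivPoint_inv n hpos hinv p.1.1 (p.1.2 + 1) p.2
    simp only
    rw [← this, Nat.sub_sub, Nat.add_comm]
  tgt_inv p := by
    have h2 := p.2
    have := Y.subdivPoint_inv n hpos hinv p.1.1 p.1.2 p.2.le
    simp only
    rw [← this]
    congr 1
    omega
  inv_inv p := by
    have h2 := p.2
    have := hinv p.1.1
    apply Subtype.ext
    simp only [Y.inv_inv, this]
    apply Prod.ext <;> simp only
    omega
  inv_ne p h := Y.inv_ne p.1.1 (congrArg (fun q : SubdivEdge n => q.1.1) h)
  finv := Y.finv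
  finv_finv := Y.finv_finv
  finv_ne := Y.finv_ne
  bdry f := (Y.bdry f).flatMap (subdivArc n)
  bdry_ne_nil f h := by
    obtain ⟨e, he⟩ := List.exists_mem_of_ne_nil _ (Y.bdry_ne_nil f)
    exact subdivArc_ne_nil n hpos e (List.flatMap_eq_nil_iff.1 h e he)
  bdry_chain f := by
    refine Y.subdiv_chain n hpos _ ?_ ?_ f
    · intro x y h1 h2
      refine ⟨by rw [h1, h2], fun h => Y.inv_ne x.1.1 ?_⟩
      exact (congrArg (fun q : SubdivEdge n => q.1.1) h).symm.trans h1.symm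
    · intro x y h1 h2 h
      refine ⟨?_, fun h' => h.2 (congrArg (fun q : SubdivEdge n => q.1.1) h')⟩
      have := hpos x.1.1
      simp only [subdivPoint]
      rw [dif_neg (by omega), dif_neg (by omega), if_neg (by omega), if_pos h2, h.1]
  bdry_finv f := by
    rw [Y.bdry_finv, List.map_flatMap, List.reverse_flatMap, ← List.map_reverse,
      List.flatMap_map]
    congr 1
    funext e
    exact Y.subdivArc_inv n hinv _ (fun _ => rfl) e

end Subdivision

end TwoComplex

/-- A geometric form: a finite connected 2-complex without isolated edges, with a length in `(0, 1]`
on every geometric edge, such that every face has boundary length at most `1`. -/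
structure GeometricForm (V E F : Type*) extends TwoComplex V E F where
  finite_verts : Finite V
  finite_edges : Finite E
  finite_faces : Finite F
  connected : toTwoComplex.IsConnected
  noIsolatedEdges : toTwoComplex.NoIsolatedEdges
  len : E → ℝ
  len_inv : ∀ e, len (inv e) = len e
  len_pos : ∀ e, 0 < len e
  len_le_one : ∀ e, len e ≤ 1
  bdry_len_le_one : ∀ f, ((bdry f).map len).sum ≤ 1

/-- The 2-complex `Y_ℓ`: every edge `e` of `Y` is divided into `⌊λ_e ℓ⌋` edges.  The maximum with `1`
only matters for the finitely many `ℓ` with some `⌊λ_e ℓ⌋ = 0`, where the division makes no sense. -/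
noncomputable def GeometricForm.scaled {V E F : Type*} (Y : GeometricForm V E F) (ℓ : ℕ) :
    TwoComplex (Y.toTwoComplex.SubdivVertex fun e => max 1 ⌊Y.len e * ℓ⌋₊)
      (TwoComplex.SubdivEdge fun e : E => max 1 ⌊Y.len e * ℓ⌋₊) F :=
  Y.toTwoComplex.subdivide (fun e => max 1 ⌊Y.len e * ℓ⌋₊)
    (fun _ => lt_of_lt_of_le Nat.one_pos (le_max_left _ _))
    (fun e => by simp only [Y.len_inv])

/-- `B_ℓ`: the cyclically reduced words of length at most `ℓ` in the letters `x_1^±, …, x_m^±`. -/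
def relatorBall (m ℓ : ℕ) : Set (List (Fin m × Bool)) :=
  {w | FreeGroup.IsCyclicallyReduced w ∧ w.length ≤ ℓ}

/-- A permutation invariant random subset `R` of a (finite) set `B`. -/
structure IsPermInvariantRandomSubset {A : Type*} (B : Set A) {Ω : Type*} [MeasurableSpace Ω]
    (P : Measure Ω) (R : Ω → Set B) : Prop where
  measurableSet_eq : ∀ S : Set B, MeasurableSet {ω | R ω = S}
  perm_invariant : ∀ (σ : Equiv.Perm B) (S : Set B), P {ω | R ω = S} = P {ω | R ω = σ '' S}

/-- The sequence of random subsets `R_ℓ` of `B_ℓ` is densable with density `d`: the random variables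
`log_{|B_ℓ|} |R_ℓ|` (with value `-∞` where `R_ℓ` is empty) converge to `d` in probability. -/
def IsDensable {A : Type*} (B : ℕ → Set A) {Ω : ℕ → Type*} [∀ ℓ, MeasurableSpace (Ω ℓ)]
    (P : ∀ ℓ, Measure (Ω ℓ)) (R : ∀ ℓ, Ω ℓ → Set (B ℓ)) (d : ℝ) : Prop :=
  ∀ ε : ℝ, 0 < ε → Tendsto (fun ℓ => P ℓ {ω | (R ℓ ω).Nonempty ∧
    |Real.logb ((B ℓ).ncard : ℝ) ((R ℓ ω).ncard : ℝ) - d| ≤ ε}) atTop (𝓝 1)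

/-- `R_ℓ` is the random set of relators of a sequence of random groups `G_ℓ(m, d) = ⟨X_m | R_ℓ⟩`
with `m` generators at density `d`. -/
structure IsRandomGroupSequence (m : ℕ) (d : ℝ) {Ω : ℕ → Type*} [∀ ℓ, MeasurableSpace (Ω ℓ)]
    (P : ∀ ℓ, Measure (Ω ℓ)) (R : ∀ ℓ, Ω ℓ → Set (relatorBall m ℓ)) : Prop where
  permInvariant : ∀ ℓ, IsPermInvariantRandomSubset (relatorBall m ℓ) (P ℓ) (R ℓ)
  densable : IsDensable (relatorBall m) P R d

/-! The proof is a second moment argument. Write `q = 2m - 1`, `b = |B_ℓ|`, and `k` for the number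
of geometric faces.

One filling of `Y_ℓ` by `B_ℓ` is turned into a large family `Φ` of fillings (`exists_edge_words`).
The words along the edges of `Y` keep their end letters, so the face labels stay cyclically reduced.
Each word begins with a short block identifying its oriented edge, so distinct faces get distinct
labels. The middle of each word is free, up to a bounded number of letters. Each `φ` in `Φ` thus
yields `k` distinct relators `W φ`, and any set of relators containing `W φ` fills `Y_ℓ`.

Count the `φ` with `W φ ⊆ R`, where `R` is a uniform `r`-subset of `B_ℓ`. Pairs with disjoint
relator sets contribute at most the square of the mean. If `φ` shares `i ≥ 1` relators with a fixed
`ψ`, a set of `i` faces has its labels prescribed by `ψ` and a matching of faces. This fixes the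
words on all edges of the spanned subcomplex `Z`, so the proportion of such `φ` is at most a
constant times `q ^ (-|Z^(1)|)` (`exists_relator_family`). The overlap raises the probability by a
factor of order `(b / r) ^ i`, about `q ^ ((1 - d) i ℓ)`. The hypothesis `|Z^(1)| ≥ (1 - d + s) i ℓ`
beats this exponentially, even if `|R|` deviates by `s / 2` in the exponent.

Cauchy–Schwarz (`choose_le_card_filter_exists_subset`) then shows that almost all `r`-subsets fill
(`choose_le_card_fillable`). Permutation invariance makes `R_ℓ` uniform given its size
(`mul_measure_le`), and densability controls that size. -/

namespace List

/-! ### Prefix codes. -/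

variable {A E : Type*}

/-- A code in which no code word is a prefix of another one is uniquely decodable. -/
theorem flatMap_injective_of_prefixFree (W : E → List A) (hne : ∀ e, W e ≠ [])
    (hW : ∀ e e', W e <+: W e' → e = e') : Function.Injective fun l : List E => l.flatMap W := by
  intro l
  induction l with
  | nil =>
    intro l' h
    cases l' with
    | nil => rfl
    | cons e l' =>
      simp only [flatMap_nil, flatMap_cons] at h
      exact absurd (append_eq_nil_iff.1 h.symm).1 (hne e)
  | cons e l ih =>
    intro l' h
    cases l' with
    | nil =>
      simp only [flatMap_nil, flatMap_cons] at h
      exact absurd (append_eq_nil_iff.1 h).1 (hne e)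
    | cons e' l' =>
      simp only [flatMap_cons] at h
      have he : e = e' := by
        rcases prefix_or_prefix_of_prefix (prefix_append (W e) (l.flatMap W))
          (h ▸ prefix_append (W e') (l'.flatMap W)) with h1 | h1
        · exact hW _ _ h1
        · exact (hW _ _ h1).symm
      subst he
      rw [ih (append_cancel_left h)]

/-- If `i < j`, position `0` gives `a = a'` and position `i + 1` gives `c = a'`, against `c ≠ a`.
The exponent can thus serve as a name even when the letters `a`, `a'` are prescribed from outside.
-/
theorem eq_of_replicate_append_prefix {i j : ℕ} {a a' c c' : A} (hc : c ≠ a)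
    (h : replicate (i + 1) a ++ [c] <+: replicate (j + 1) a' ++ [c']) : i = j := by
  have hlen := h.length_le
  simp only [length_append, length_replicate, length_singleton] at hlen
  by_contra hij
  have hlt : i < j := by omega
  have h0 := h.getElem (i := 0) (by simp)
  have h1 := h.getElem (i := i + 1) (by simp)
  rw [getElem_append_left (by simp), getElem_append_left (by simp)] at h0
  rw [getElem_append_right (by simp), getElem_append_left (by simp; omega)] at h1
  simp at h0 h1
  exact hc (h1.trans h0.symm)

end List

/-! ### Reduced words and their number. -/

namespace FreeGroup

variable {α E : Type*}

/-- Cyclic reducedness of a concatenation of reduced words depends only on their end letters. -/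
theorem IsCyclicallyReduced.flatMap_congr {W W' : E → List (α × Bool)} (hne : ∀ e, W e ≠ [])
    (hne' : ∀ e, W' e ≠ []) (hhead : ∀ e, (W' e).head? = (W e).head?)
    (hlast : ∀ e, (W' e).getLast? = (W e).getLast?) (hred : ∀ e, IsReduced (W' e)) {l : List E}
    (h : IsCyclicallyReduced (l.flatMap W)) : IsCyclicallyReduced (l.flatMap W') := by
  obtain ⟨h1, h2⟩ := h
  refine ⟨?_, ?_⟩
  · rw [IsReduced, List.flatMap, List.isChain_flatten (by simpa using fun e _ => hne e)] at h1
    rw [IsReduced, List.flatMap, List.isChain_flatten (by simpa using fun e _ => hne' e)]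
    refine ⟨fun w hw => by obtain ⟨e, -, rfl⟩ := List.mem_map.1 hw; exact hred e, ?_⟩
    rw [List.isChain_map]
    rw [List.isChain_map] at h1
    simpa only [hhead, hlast] using h1.2
  · simpa only [List.head?_flatMap, List.getLast?_flatMap, hhead, hlast] using h2

theorem IsReduced.invRev {w : List (α × Bool)} (h : IsReduced w) : IsReduced (invRev w) := by
  rw [IsReduced, FreeGroup.invRev, List.isChain_reverse, List.isChain_map]
  refine List.IsChain.imp ?_ h
  intro a b hab h
  simp [hab h.symm]

theorem isReduced_replicate (n : ℕ) (a : α × Bool) : IsReduced (List.replicate n a) :=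
  List.isChain_replicate_of_rel _ fun _ => rfl

theorem IsCyclicallyReduced.invRev {w : List (α × Bool)} (h : IsCyclicallyReduced w) :
    IsCyclicallyReduced (invRev w) := by
  refine ⟨h.1.invRev, ?_⟩
  intro a ha b hb hab
  simp only [FreeGroup.invRev, List.getLast?_reverse, List.head?_reverse, List.head?_map,
    List.getLast?_map, Option.mem_def, Option.map_eq_some_iff] at ha hb
  obtain ⟨a, ha, rfl⟩ := ha
  obtain ⟨b, hb, rfl⟩ := hb
  simpa using (h.2 b hb a ha hab.symm).symm

section Counting

variable [Fintype α] [DecidableEq α]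

theorem card_filter_not_inverse (a : α × Bool) :
    (Finset.univ.filter fun c : α × Bool => a.1 = c.1 → a.2 = c.2).card
      = 2 * Fintype.card α - 1 := by
  have : (Finset.univ.filter fun c : α × Bool => a.1 = c.1 → a.2 = c.2)
      = Finset.univ.erase (a.1, !a.2) := by
    ext ⟨c1, c2⟩
    obtain ⟨a1, a2⟩ := a
    simp only [Finset.mem_filter, Finset.mem_univ, true_and, Finset.mem_erase, ne_eq,
      Prod.mk.injEq, and_true, not_and]
    by_cases h : a1 = c1
    · subst h
      cases a2 <;> cases c2 <;> simp
    · simp [h, Ne.symm h]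
  rw [this, Finset.card_erase_of_mem (Finset.mem_univ _)]
  simp [mul_comm]

/-- The words `x` of length `n` such that `a x b` is reduced. -/
def bridges (b : α × Bool) : ℕ → α × Bool → Finset (List (α × Bool))
  | 0, a => if a.1 = b.1 → a.2 = b.2 then {[]} else ∅
  | n + 1, a => (Finset.univ.filter fun c : α × Bool => a.1 = c.1 → a.2 = c.2).biUnion
      fun c => (bridges b n c).image (List.cons c)

theorem mem_bridges {a b : α × Bool} {n : ℕ} {x : List (α × Bool)} :
    x ∈ bridges b n a ↔ x.length = n ∧ IsReduced (a :: x ++ [b]) := by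
  induction n generalizing a x with
  | zero =>
    rw [bridges]
    split_ifs with h
    · simp only [Finset.mem_singleton, List.length_eq_zero_iff]
      constructor
      · rintro rfl; simpa [IsReduced] using h
      · exact fun h => h.1
    · simp only [Finset.notMem_empty, List.length_eq_zero_iff, false_iff]
      rintro ⟨rfl, h'⟩
      exact h (by simpa [IsReduced] using h')
  | succ n ih =>
    rw [bridges]
    simp only [Finset.mem_biUnion, Finset.mem_filter, Finset.mem_univ, true_and, Finset.mem_image,
      ih]
    constructor
    · rintro ⟨c, hc, y, ⟨hy, hy'⟩, rfl⟩
      refine ⟨by simp [hy], ?_⟩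
      simp only [List.cons_append] at hy' ⊢
      exact isReduced_cons_cons.2 ⟨hc, hy'⟩
    · rintro ⟨hx, hx'⟩
      cases x with
      | nil => simp at hx
      | cons c y =>
        simp only [List.cons_append] at hx'
        obtain ⟨h1, h2⟩ := isReduced_cons_cons.1 hx'
        exact ⟨c, h1, y, ⟨by simpa using hx, h2⟩, rfl⟩

/-- The first `n` letters each have `q` free choices. Only the last one must suit both its
neighbours, and a second generator makes this possible, at the cost of one letter of freedom. -/
theorem pow_le_card_bridges (hα : 2 ≤ Fintype.card α) (b : α × Bool) (n : ℕ) (a : α × Bool) :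
    (2 * Fintype.card α - 1) ^ n ≤ (bridges b (n + 1) a).card := by
  induction n generalizing a with
  | zero =>
    rw [pow_zero, Nat.one_le_iff_ne_zero, Finset.card_ne_zero]
    obtain ⟨g, hg⟩ : ∃ g : α, g ≠ a.1 := by
      by_contra! h
      have := Fintype.card_le_one_iff.2 fun x y => (h x).trans (h y).symm
      omega
    by_cases hb : b.1 = g
    · refine ⟨[b], mem_bridges.2 ⟨rfl, ?_⟩⟩
      simp only [List.cons_append, List.nil_append, isReduced_cons_cons, IsReduced.singleton,
        implies_true, and_true]
      exact fun h => absurd (h.trans hb).symm hg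
    · refine ⟨[(g, true)], mem_bridges.2 ⟨rfl, ?_⟩⟩
      simp only [List.cons_append, List.nil_append, isReduced_cons_cons, IsReduced.singleton,
        and_true]
      exact ⟨fun h => absurd h.symm hg, fun h => absurd h.symm hb⟩
  | succ n ih =>
    rw [bridges, Finset.card_biUnion]
    · rw [pow_succ', ← card_filter_not_inverse a, ← smul_eq_mul]
      refine Finset.card_nsmul_le_sum _ _ _ fun c _ => ?_
      rw [Finset.card_image_of_injective _ List.cons_injective, card_filter_not_inverse]
      exact ih c
    · intro c _ c' _ hcc'
      rw [Function.onFun, Finset.disjoint_left]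
      intro x hx hx'
      obtain ⟨y, -, rfl⟩ := Finset.mem_image.1 hx
      obtain ⟨y', -, h⟩ := Finset.mem_image.1 hx'
      exact hcc' (List.cons_eq_cons.1 h).1.symm

/-- A cover suffices for an upper bound. The `+ 1` on the left closes the induction: `1 + q (2 q ^ n
- 1) + 1 ≤ 2 q ^ (n + 1)` because `q ≥ 2`. -/
theorem exists_cover_reduced (hα : 2 ≤ Fintype.card α) (n : ℕ) (a : α × Bool) :
    ∃ s : Finset (List (α × Bool)), (∀ x, x.length ≤ n → IsReduced (a :: x) → x ∈ s) ∧
      s.card + 1 ≤ 2 * (2 * Fintype.card α - 1) ^ n := by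
  induction n generalizing a with
  | zero =>
    refine ⟨{[]}, ?_, by simp⟩
    intro x hx _
    simpa using hx
  | succ n ih =>
    choose s hs hcard using ih
    set q := 2 * Fintype.card α - 1 with hq
    refine ⟨insert [] ((Finset.univ.filter fun c : α × Bool => a.1 = c.1 → a.2 = c.2).biUnion
      fun c => (s c).image (List.cons c)), ?_, ?_⟩
    · intro x hx hx'
      cases x with
      | nil => simp
      | cons c y =>
        obtain ⟨h1, h2⟩ := isReduced_cons_cons.1 hx'
        refine Finset.mem_insert_of_mem (Finset.mem_biUnion.2 ⟨c, by simpa using h1,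
          Finset.mem_image_of_mem _ (hs c y (by simpa using hx) h2)⟩)
    · have h1 : ((Finset.univ.filter fun c : α × Bool => a.1 = c.1 → a.2 = c.2).biUnion
          fun c => (s c).image (List.cons c)).card ≤ q * (2 * q ^ n - 1) := by
        rw [hq, ← card_filter_not_inverse a]
        refine Finset.card_biUnion_le_card_mul _ _ _ fun c _ => ?_
        refine Finset.card_image_le.trans ?_
        rw [card_filter_not_inverse, ← hq]
        exact Nat.le_sub_of_add_le (hcard c)
      have h2 := Finset.card_insert_le ([] : List (α × Bool)) ((Finset.univ.filter fun c : α × Bool => a.1 = c.1 → a.2 = c.2).biUnion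
          fun c => (s c).image (List.cons c))
      have h3 : 1 ≤ q ^ n := Nat.one_le_pow _ _ (by omega)
      have h4 : q * (2 * q ^ n - 1) + q = 2 * q ^ (n + 1) := by
        obtain ⟨t, ht⟩ := Nat.exists_eq_add_of_le h3
        rw [pow_succ, ht, show 2 * (1 + t) - 1 = 1 + 2 * t by omega]
        ring
      omega

end Counting

end FreeGroup

/-! ### The size of `B_ℓ`. -/

theorem relatorBall_finite (m ℓ : ℕ) : (relatorBall m ℓ).Finite :=
  (List.finite_length_le _ ℓ).subset fun _ hw => hw.2

/-- The two extra powers of `q` absorb the choice of the first letter and the sum over lengths,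
since `2 q + 3 ≤ q ^ 2` for `q ≥ 3`. -/
theorem ncard_relatorBall_le {m : ℕ} (hm : 2 ≤ m) (ℓ : ℕ) :
    (relatorBall m ℓ).ncard ≤ (2 * m - 1) ^ (ℓ + 2) := by
  have hm' : 2 ≤ Fintype.card (Fin m) := by simpa using hm
  choose s hs hcard using fun c => FreeGroup.exists_cover_reduced hm' ℓ c
  simp only [Fintype.card_fin] at hcard
  set q := 2 * m - 1 with hq
  have hsub : relatorBall m ℓ ⊆ (insert [] (Finset.univ.biUnion
      fun c : Fin m × Bool => (s c).image (List.cons c)) : Finset (List (Fin m × Bool))) := by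
    rintro w ⟨hw, hlen⟩
    cases w with
    | nil => simp
    | cons c y =>
      rw [Finset.mem_coe]
      refine Finset.mem_insert_of_mem (Finset.mem_biUnion.2 ⟨c, Finset.mem_univ _,
        Finset.mem_image_of_mem _ (hs c y ?_ hw.1)⟩)
      simp only [List.length_cons] at hlen
      omega
  have h1 := Set.ncard_le_ncard hsub (Finset.finite_toSet _)
  rw [Set.ncard_coe_finset] at h1
  have h2 : (Finset.univ.biUnion
      fun c : Fin m × Bool => (s c).image (List.cons c)).card ≤ (q + 1) * (2 * q ^ ℓ) := by
    have : q + 1 = (Finset.univ : Finset (Fin m × Bool)).card := by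
      simp [hq]
      omega
    rw [this]
    refine Finset.card_biUnion_le_card_mul _ _ _ fun c _ => Finset.card_image_le.trans ?_
    have := hcard c
    omega
  have h3 := Finset.card_insert_le ([] : List (Fin m × Bool)) (Finset.univ.biUnion
      fun c : Fin m × Bool => (s c).image (List.cons c))
  have h4 : 1 ≤ q ^ ℓ := Nat.one_le_pow _ _ (by omega)
  have h5 : 3 ≤ q := by omega
  calc _ ≤ (q + 1) * (2 * q ^ ℓ) + 1 := by omega
    _ ≤ (q + 1) * (2 * q ^ ℓ) + q ^ ℓ := by omega
    _ = q ^ ℓ * (2 * q + 3) := by ring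
    _ ≤ q ^ ℓ * (q * q) := by gcongr; nlinarith
    _ = q ^ (ℓ + 2) := by ring

/-- Powers of one letter are enough: the bound only serves to make `b > 1` and to push `r` above `2
k`. -/
theorem le_ncard_relatorBall {m : ℕ} (hm : 2 ≤ m) (ℓ : ℕ) : ℓ ≤ (relatorBall m ℓ).ncard := by
  let a : Fin m × Bool := (⟨0, by omega⟩, true)
  have hinj : Function.Injective fun n : ℕ => List.replicate n a := fun i j h => by
    simpa using congrArg List.length h
  have hsub : ((Finset.range ℓ).image fun n => List.replicate n a : Set (List (Fin m × Bool)))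
      ⊆ relatorBall m ℓ := by
    intro w hw
    obtain ⟨n, hn, rfl⟩ := Finset.mem_image.1 (Finset.mem_coe.1 hw)
    refine ⟨⟨FreeGroup.isReduced_replicate n a, ?_⟩, by simpa using (Finset.mem_range.1 hn).le⟩
    intro x hx y hy _
    rw [(List.mem_replicate.1 (List.mem_of_getLast? hx)).2,
      (List.mem_replicate.1 (List.mem_of_head? hy)).2]
  have := Set.ncard_le_ncard hsub (relatorBall_finite m ℓ)
  rwa [Set.ncard_coe_finset, Finset.card_image_of_injective _ hinj, Finset.card_range] at this

/-! ### Inclusion probabilities for uniform `r`-subsets. -/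

/-- The proportion of the `r`-subsets of a `b`-set that contain a given `j`-subset. -/
noncomputable def supersetRatio (b r j : ℕ) : ℝ :=
  ∏ t ∈ Finset.range j, ((r : ℝ) - t) / ((b : ℝ) - t)

theorem choose_sub_eq_supersetRatio {b r j : ℕ} (hj : j ≤ r) (hr : r ≤ b) :
    ((b - j).choose (r - j) : ℝ) = b.choose r * supersetRatio b r j := by
  induction j with
  | zero => simp [supersetRatio]
  | succ j ih =>
    have hb : (0 : ℝ) < (b : ℝ) - j := by
      rw [sub_pos, Nat.cast_lt]; omega
    have h := Nat.add_one_mul_choose_eq (b - (j + 1)) (r - (j + 1))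
    rw [show b - (j + 1) + 1 = b - j by omega,
      show r - (j + 1) + 1 = r - j by omega] at h
    have h' : ((b : ℝ) - j) * ((b - (j + 1)).choose (r - (j + 1)) : ℝ)
        = ((b - j).choose (r - j) : ℝ) * ((r : ℝ) - j) := by
      rw [← Nat.cast_sub (by omega), ← Nat.cast_sub (by omega)]
      exact_mod_cast h
    rw [supersetRatio, Finset.prod_range_succ, ← mul_assoc, ← supersetRatio, ← ih (by omega)]
    field_simp
    linarith

theorem card_filter_superset {B : Type*} [Fintype B] [DecidableEq B] (W : Finset B) {r : ℕ}
    (hW : W.card ≤ r) :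
    ((Finset.powersetCard r Finset.univ).filter fun S => W ⊆ S).card
      = (Fintype.card B - W.card).choose (r - W.card) := by
  have h : ((Finset.powersetCard r Finset.univ).filter fun S => W ⊆ S)
      = (Finset.powersetCard (r - W.card) Wᶜ).image fun T => W ∪ T := by
    ext S
    simp only [Finset.mem_filter, Finset.mem_powersetCard, Finset.subset_univ, true_and,
      Finset.mem_image]
    constructor
    · rintro ⟨hS, hWS⟩
      refine ⟨S \ W, ⟨?_, ?_⟩, Finset.union_sdiff_of_subset hWS⟩
      · intro x hx
        simpa using (Finset.mem_sdiff.1 hx).2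
      · rw [Finset.card_sdiff_of_subset hWS, hS]
    · rintro ⟨T, ⟨hT, hcard⟩, rfl⟩
      refine ⟨?_, Finset.subset_union_left⟩
      rw [Finset.card_union_of_disjoint, hcard]
      · omega
      · exact (Finset.subset_compl_iff_disjoint_left.1 hT)
  rw [h, Finset.card_image_of_injOn, Finset.card_powersetCard, Finset.card_compl]
  intro T hT T' hT' hTT'
  have d1 := Finset.subset_compl_iff_disjoint_left.1 (Finset.mem_powersetCard.1 hT).1
  have d2 := Finset.subset_compl_iff_disjoint_left.1 (Finset.mem_powersetCard.1 hT').1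
  have := congrArg (· \ W) hTT'
  simpa [Finset.union_sdiff_cancel_left d1, Finset.union_sdiff_cancel_left d2] using this

section

variable {b r k : ℕ}

theorem supersetRatio_pos (hr : r ≤ b) {j : ℕ} (hj : j ≤ r) : 0 < supersetRatio b r j := by
  refine Finset.prod_pos fun t ht => ?_
  have ht := Finset.mem_range.1 ht
  have h1 : (t : ℝ) < r := by exact_mod_cast (by omega : t < r)
  have h2 : (t : ℝ) < b := by exact_mod_cast (by omega : t < b)
  exact div_pos (by linarith) (by linarith)

/-- The factors `(r - t) / (b - t)` decrease in `t`, so containing two disjoint sets is negatively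
correlated. The absence of a constant here gives the second moment bound its leading term `1`. -/
theorem supersetRatio_add_le (hr : r ≤ b) (hk : 2 * k ≤ r) :
    supersetRatio b r (k + k) ≤ supersetRatio b r k ^ 2 := by
  have hp := supersetRatio_pos hr (show k ≤ r by omega)
  rw [supersetRatio, Finset.prod_range_add, sq, ← supersetRatio]
  refine mul_le_mul_of_nonneg_left ?_ hp.le
  have hrb : (r : ℝ) ≤ b := by exact_mod_cast hr
  refine Finset.prod_le_prod ?_ ?_
  all_goals
    intro t ht
    have ht := Finset.mem_range.1 ht
    have h1 : ((k + t : ℕ) : ℝ) < r := by exact_mod_cast (by omega : k + t < r)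
    have h3 : ((t : ℕ) : ℝ) ≤ (k + t : ℕ) := by exact_mod_cast (by omega : t ≤ k + t)
  · exact div_nonneg (by linarith) (by linarith)
  · rw [div_le_div_iff₀ (by linarith) (by linarith)]
    nlinarith

theorem supersetRatio_le_pow (hr : r ≤ b) {j : ℕ} (hj : j ≤ r) :
    supersetRatio b r j ≤ ((r : ℝ) / b) ^ j := by
  have hrb : (r : ℝ) ≤ b := by exact_mod_cast hr
  calc supersetRatio b r j ≤ ∏ _t ∈ Finset.range j, ((r : ℝ) / b) := by
        refine Finset.prod_le_prod ?_ ?_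
        all_goals
          intro t ht
          have ht := Finset.mem_range.1 ht
          have h1 : ((t : ℕ) : ℝ) < r := by exact_mod_cast (by omega : t < r)
          have h3 : (0 : ℝ) ≤ t := Nat.cast_nonneg t
        · exact div_nonneg (by linarith) (by linarith)
        · rw [div_le_div_iff₀ (by linarith) (by linarith)]
          nlinarith
    _ = _ := by rw [Finset.prod_const, Finset.card_range]

/-- For `t < k` and `2 k ≤ r` one has `r - t ≥ r / 2`. -/
theorem pow_le_supersetRatio (hr : r ≤ b) (hk : 2 * k ≤ r) :
    ((r : ℝ) / b / 2) ^ k ≤ supersetRatio b r k := by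
  have hrb : (r : ℝ) ≤ b := by exact_mod_cast hr
  have hr2 : (2 * k : ℝ) ≤ r := by exact_mod_cast hk
  calc ((r : ℝ) / b / 2) ^ k = ∏ _t ∈ Finset.range k, ((r : ℝ) / b / 2) := by
        rw [Finset.prod_const, Finset.card_range]
    _ ≤ supersetRatio b r k := by
        refine Finset.prod_le_prod (fun _ _ => by positivity) ?_
        intro t ht
        have ht := Finset.mem_range.1 ht
        have h1 : ((t : ℕ) : ℝ) < k := by exact_mod_cast ht
        have h3 : (0 : ℝ) ≤ t := Nat.cast_nonneg t
        rw [div_div, div_le_div_iff₀ (by linarith) (by linarith)]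
        nlinarith

/-- Compare `(r / b) ^ (2 k - i)` with the square of `(r / (2 b)) ^ k`; the halves produce `4 ^ k`.
-/
theorem supersetRatio_sub_le (hr : r ≤ b) (hk : 2 * k ≤ r) (h0 : 0 < r) {i : ℕ} (hi : i ≤ k) :
    supersetRatio b r (k + k - i)
      ≤ 4 ^ k * ((b : ℝ) / r) ^ i * supersetRatio b r k ^ 2 := by
  have hr0 : (0 : ℝ) < r := by exact_mod_cast h0
  have hb0 : (0 : ℝ) < b := by exact_mod_cast (by omega : 0 < b)
  refine (supersetRatio_le_pow hr (by omega)).trans ?_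
  have h1 : (((r : ℝ) / b / 2) ^ k) ^ 2 ≤ supersetRatio b r k ^ 2 :=
    pow_le_pow_left₀ (by positivity) (pow_le_supersetRatio hr hk) 2
  refine le_trans (le_of_eq ?_) (mul_le_mul_of_nonneg_left h1 (by positivity))
  have h2 : ((r : ℝ) / b) ^ (k + k) = ((r : ℝ) / b) ^ (k + k - i) * ((r : ℝ) / b) ^ i := by
    rw [← pow_add]; congr 1; omega
  have h3 : ((b : ℝ) / r) ^ i * ((r : ℝ) / b) ^ i = 1 := by
    rw [← mul_pow, div_mul_div_cancel₀ hr0.ne', div_self hb0.ne', one_pow]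
  have h4 : (4 : ℝ) ^ k = (2 ^ k) ^ 2 := by
    rw [← pow_mul, mul_comm k 2, pow_mul]; norm_num
  rw [div_pow _ 2, div_pow _ (2 ^ k), ← pow_mul, mul_two, h2, h4, mul_assoc, mul_div_assoc',
    mul_div_assoc', mul_div_cancel_left₀ _ (by positivity)]
  linear_combination -((r : ℝ) / b) ^ (k + k - i) * h3

end

/-! ### The second moment method. -/

open Classical in
/-- Second moment bound: if the members of a family of `k`-subsets of a set `B` have few overlaps,
then most `r`-subsets of `B` contain a member of the family. -/
theorem choose_le_card_filter_exists_subset {B ι κ : Type*} [Fintype B] [DecidableEq B]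
    (Φ : Finset ι) (hΦ : Φ.Nonempty) (W : ι → Finset B) {k r : ℕ}
    (hW : ∀ φ ∈ Φ, (W φ).card = k) (h0 : 0 < r) (hk : 2 * k ≤ r) (hr : r ≤ Fintype.card B)
    (J : Finset κ) (M : κ → ι → ι → Prop) (sz : κ → ℕ) (η : ℝ)
    (hJ : ∀ φ ∈ Φ, ∀ ψ ∈ Φ, (W φ ∩ W ψ).card ≠ 0 →
      ∃ j ∈ J, sz j = (W φ ∩ W ψ).card ∧ M j φ ψ)
    (hη : ∀ j ∈ J, ∀ ψ ∈ Φ, ((Φ.filter fun φ => M j φ ψ).card : ℝ)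
      * ((Fintype.card B : ℝ) / r) ^ sz j ≤ η * Φ.card) :
    ((Fintype.card B).choose r : ℝ) ≤ (1 + 4 ^ k * J.card * η) *
      ((Finset.powersetCard r Finset.univ).filter fun S => ∃ φ ∈ Φ, W φ ⊆ S).card := by
  set b := Fintype.card B with hb
  set p := supersetRatio b r with hp
  set C : ℝ := (b.choose r : ℝ) with hC
  have hCpos : 0 < C := Nat.cast_pos.2 (Nat.choose_pos hr)
  have hpk : 0 < p k := supersetRatio_pos hr (by omega)
  set 𝒮 := Finset.powersetCard r (Finset.univ : Finset B) with h𝒮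
  -- The counting variable whose first two moments are compared.
  set N : Finset B → ℝ := fun S => ((Φ.filter fun φ => W φ ⊆ S).card : ℝ) with hN
  have hNsum : ∀ S, N S = ∑ φ ∈ Φ, if W φ ⊆ S then (1 : ℝ) else 0 := by
    intro S; simp [hN]
  have hsup : ∀ T : Finset B, T.card ≤ r →
      ∑ S ∈ 𝒮, (if T ⊆ S then (1 : ℝ) else 0) = C * p T.card := by
    intro T hT
    rw [Finset.sum_boole, h𝒮, card_filter_superset T hT, choose_sub_eq_supersetRatio hT hr]
  have hunion : ∀ φ ∈ Φ, ∀ ψ ∈ Φ, (W φ ∪ W ψ).card = k + k - (W φ ∩ W ψ).card := by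
    intro φ hφ ψ hψ
    have := Finset.card_union_add_card_inter (W φ) (W ψ)
    rw [hW φ hφ, hW ψ hψ] at this
    omega
  have hfirst : ∑ S ∈ 𝒮, N S = Φ.card * (C * p k) := by
    simp_rw [hNsum]
    rw [Finset.sum_comm, Finset.sum_congr rfl fun φ hφ =>
      (hsup (W φ) (by rw [hW φ hφ]; omega)).trans (by rw [hW φ hφ])]
    simp
  have hsecond : ∑ S ∈ 𝒮, N S ^ 2 = ∑ φ ∈ Φ, ∑ ψ ∈ Φ, C * p (W φ ∪ W ψ).card := by
    simp_rw [hNsum, sq, Finset.sum_mul_sum]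
    rw [Finset.sum_comm]
    refine Finset.sum_congr rfl fun φ hφ => ?_
    rw [Finset.sum_comm]
    refine Finset.sum_congr rfl fun ψ hψ => ?_
    rw [← hsup (W φ ∪ W ψ) (by rw [hunion φ hφ ψ hψ]; omega)]
    refine Finset.sum_congr rfl fun S _ => ?_
    simp only [Finset.union_subset_iff, ite_and]
    split_ifs <;> simp
  have hpair : ∀ φ ∈ Φ, ∀ ψ ∈ Φ, p (W φ ∪ W ψ).card ≤
      p k ^ 2 * (1 + 4 ^ k * ∑ j ∈ J, (if M j φ ψ then ((b : ℝ) / r) ^ sz j else 0)) := by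
    intro φ hφ ψ hψ
    have hnonneg : ∀ j ∈ J, (0 : ℝ) ≤ (if M j φ ψ then ((b : ℝ) / r) ^ sz j else 0) := by
      intro j _
      split_ifs <;> positivity
    rw [hunion φ hφ ψ hψ]
    by_cases hi : (W φ ∩ W ψ).card = 0
    · rw [hi, Nat.sub_zero]
      refine (supersetRatio_add_le hr hk).trans (le_mul_of_one_le_right (by positivity) ?_)
      have := Finset.sum_nonneg hnonneg
      have : 0 ≤ (4 : ℝ) ^ k * ∑ j ∈ J, (if M j φ ψ then ((b : ℝ) / r) ^ sz j else 0) := by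
        positivity
      linarith
    · obtain ⟨j, hj, hsz, hM⟩ := hJ φ hφ ψ hψ hi
      have hik : (W φ ∩ W ψ).card ≤ k := by
        rw [← hW φ hφ]; exact Finset.card_le_card Finset.inter_subset_left
      refine (supersetRatio_sub_le hr hk h0 hik).trans ?_
      have h1 := Finset.single_le_sum hnonneg hj
      rw [if_pos hM, hsz] at h1
      have h2 : (0 : ℝ) < 4 ^ k := by positivity
      rw [mul_comm]
      refine mul_le_mul_of_nonneg_left ?_ (by positivity)
      nlinarith [mul_le_mul_of_nonneg_left h1 h2.le]
  have hbound : ∑ S ∈ 𝒮, N S ^ 2 ≤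
      C * p k ^ 2 * Φ.card ^ 2 * (1 + 4 ^ k * J.card * η) := by
    rw [hsecond, Finset.sum_comm]
    have hinner : ∀ ψ ∈ Φ, ∑ φ ∈ Φ, C * p (W φ ∪ W ψ).card ≤
        C * p k ^ 2 * (Φ.card + 4 ^ k * J.card * (η * Φ.card)) := by
      intro ψ hψ
      rw [← Finset.mul_sum, mul_assoc]
      refine mul_le_mul_of_nonneg_left ?_ hCpos.le
      refine (Finset.sum_le_sum fun φ hφ => hpair φ hφ ψ hψ).trans ?_
      rw [← Finset.mul_sum]
      refine mul_le_mul_of_nonneg_left ?_ (by positivity)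
      rw [Finset.sum_add_distrib, ← Finset.mul_sum, Finset.sum_comm]
      simp only [Finset.sum_const, nsmul_eq_mul, mul_one]
      rw [mul_assoc]
      refine add_le_add_right (mul_le_mul_of_nonneg_left ?_ (by positivity)) _
      rw [← nsmul_eq_mul]
      refine Finset.sum_le_card_nsmul _ _ _ fun j hj => ?_
      rw [← Finset.sum_filter, Finset.sum_const, nsmul_eq_mul]
      exact hη j hj ψ hψ
    refine (Finset.sum_le_card_nsmul _ _ _ hinner).trans (le_of_eq ?_)
    rw [nsmul_eq_mul]
    ring
  set H := 𝒮.filter fun S => ∃ φ ∈ Φ, W φ ⊆ S with hH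
  have hNH : ∑ S ∈ H, N S = ∑ S ∈ 𝒮, N S := by
    rw [hH, Finset.sum_filter]
    refine Finset.sum_congr rfl fun S _ => ?_
    split_ifs with h
    · rfl
    · push Not at h
      rw [hNsum]
      exact (Finset.sum_eq_zero fun φ hφ => if_neg (h φ hφ)).symm
  -- `N` vanishes off `H`, so Cauchy–Schwarz on `H` bounds `H.card` from below by the squared first
  -- moment over the second.
  have hcs : (∑ S ∈ H, N S) ^ 2 ≤ H.card * ∑ S ∈ 𝒮, N S ^ 2 :=
    sq_sum_le_card_mul_sum_sq.trans (mul_le_mul_of_nonneg_left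
      (Finset.sum_le_sum_of_subset_of_nonneg (Finset.filter_subset _ _) fun _ _ _ => sq_nonneg _)
      (Nat.cast_nonneg _))
  rw [hNH, hfirst] at hcs
  have hfin := hcs.trans (mul_le_mul_of_nonneg_left hbound (Nat.cast_nonneg _))
  have hΦ0 : (0 : ℝ) < Φ.card := by exact_mod_cast hΦ.card_pos
  have hK : 0 < C * p k ^ 2 * (Φ.card : ℝ) ^ 2 := by positivity
  refine le_of_mul_le_mul_left ?_ hK
  linarith

/-! ### Permutation invariant random subsets are uniform given their size. -/

namespace IsPermInvariantRandomSubset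

variable {A Ω : Type*} {B : Set A} [MeasurableSpace Ω] {P : Measure Ω} {R : Ω → Set B}

/-- A bijection between equinumerous subsets of a finite set extends to a permutation of the whole
set. -/
theorem measure_eq_of_card_eq [Finite B] (hR : IsPermInvariantRandomSubset B P R)
    {S T : Finset B} (h : S.card = T.card) :
    P {ω | R ω = (S : Set B)} = P {ω | R ω = (T : Set B)} := by
  classical
  have := Fintype.ofFinite B
  let e : {x // x ∈ S} ≃ {x // x ∈ T} := Finset.equivOfCardEq h
  have hsub : (S.image e.extendSubtype) = T := by
    refine Finset.eq_of_subset_of_card_le ?_ ?_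
    · intro y hy
      obtain ⟨x, hx, rfl⟩ := Finset.mem_image.1 hy
      exact e.extendSubtype_mem x hx
    · rw [Finset.card_image_of_injective _ e.extendSubtype.injective, h]
  rw [hR.perm_invariant e.extendSubtype (S : Set B), ← Finset.coe_image, hsub]

open Classical in
theorem measure_mem_eq_sum [Fintype B] (hR : IsPermInvariantRandomSubset B P R)
    (𝒜 : Set (Set B)) :
    P {ω | R ω ∈ 𝒜} = ∑ S ∈ Finset.univ.filter (fun S : Finset B => (S : Set B) ∈ 𝒜),
      P {ω | R ω = (S : Set B)} := by
  rw [← measure_biUnion_finset]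
  · congr 1
    ext ω
    simp only [Set.mem_ofPred_eq, Finset.mem_filter, Finset.mem_univ, true_and, Set.mem_iUnion,
      exists_prop]
    constructor
    · exact fun h => ⟨(R ω).toFinset, by simpa using h, by simp⟩
    · rintro ⟨S, hS, h⟩
      rwa [h]
  · intro S _ T _ hST
    rw [Function.onFun, Set.disjoint_left]
    intro ω hS hT
    exact hST (Finset.coe_injective (hS.symm.trans hT))
  · exact fun S _ => hR.measurableSet_eq S

open Classical in
/-- If for every size `r ∈ G` at least the proportion `c` of the `r`-subsets of `B` lies in `𝒜`,
then a random subset whose size is in `G` lies in `𝒜` with probability at least `c`. -/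
theorem mul_measure_le [Fintype B] (hR : IsPermInvariantRandomSubset B P R)
    (𝒜 : Set (Set B)) (G : Set ℕ) (c : ℝ) (hc : 0 ≤ c)
    (h : ∀ r ∈ G, r ≤ Fintype.card B → c * ((Fintype.card B).choose r : ℝ) ≤
      ((Finset.powersetCard r Finset.univ).filter fun S : Finset B => (S : Set B) ∈ 𝒜).card) :
    ENNReal.ofReal c * P {ω | (R ω).ncard ∈ G} ≤ P {ω | R ω ∈ 𝒜} := by
  set p : Finset B → ENNReal := fun S => P {ω | R ω = (S : Set B)} with hp
  have key : ∀ r ∈ G, ENNReal.ofReal c * ∑ S ∈ Finset.powersetCard r Finset.univ, p S ≤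
      ∑ S ∈ (Finset.powersetCard r Finset.univ).filter fun S : Finset B => (S : Set B) ∈ 𝒜,
        p S := by
    intro r hr
    rcases (Finset.powersetCard r (Finset.univ : Finset B)).eq_empty_or_nonempty with h0 | ⟨T, hT⟩
    · simp [h0]
    · have hTr := (Finset.mem_powersetCard.1 hT).2
      have hconst : ∀ S ∈ Finset.powersetCard r (Finset.univ : Finset B), p S = p T :=
        fun S hS => hR.measure_eq_of_card_eq ((Finset.mem_powersetCard.1 hS).2.trans hTr.symm)
      rw [Finset.sum_congr rfl hconst,
        Finset.sum_congr rfl fun S hS => hconst S (Finset.mem_filter.1 hS).1]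
      simp only [Finset.sum_const, nsmul_eq_mul, Finset.card_powersetCard, Finset.card_univ]
      rw [← mul_assoc]
      gcongr
      rw [← ENNReal.ofReal_natCast, ← ENNReal.ofReal_mul hc, ← ENNReal.ofReal_natCast]
      exact ENNReal.ofReal_le_ofReal (h r hr (hTr ▸ Finset.card_le_univ T))
  have hG : P {ω | (R ω).ncard ∈ G} = ∑ r ∈ Finset.range (Fintype.card B + 1) with r ∈ G,
      ∑ S ∈ Finset.powersetCard r Finset.univ, p S := by
    have h1 := hR.measure_mem_eq_sum {S | S.ncard ∈ G}
    simp only [Set.mem_ofPred_eq, Set.ncard_coe_finset] at h1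
    rw [h1, ← Finset.sum_fiberwise_of_maps_to (g := Finset.card)
      (t := (Finset.range (Fintype.card B + 1)).filter (· ∈ G))]
    · refine Finset.sum_congr rfl fun r hr => Finset.sum_congr ?_ fun _ _ => rfl
      ext S
      simp only [Finset.mem_filter, Finset.mem_univ, true_and, Finset.mem_powersetCard,
        Finset.subset_univ]
      exact ⟨fun h => h.2, fun h => ⟨h ▸ (Finset.mem_filter.1 hr).2, h⟩⟩
    · intro S hS
      exact Finset.mem_filter.2 ⟨Finset.mem_range.2 (Nat.lt_succ_of_le (Finset.card_le_univ S)),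
        (Finset.mem_filter.1 hS).2⟩
  rw [hG, hR.measure_mem_eq_sum 𝒜, Finset.mul_sum]
  refine (Finset.sum_le_sum fun r hr => key r (Finset.mem_filter.1 hr).2).trans ?_
  rw [← Finset.sum_biUnion]
  · refine Finset.sum_le_sum_of_subset fun S hS => ?_
    obtain ⟨r, -, hr⟩ := Finset.mem_biUnion.1 hS
    exact Finset.mem_filter.2 ⟨Finset.mem_univ _, (Finset.mem_filter.1 hr).2⟩
  · intro r _ r' _ hrr'
    rw [Function.onFun, Finset.disjoint_left]
    intro S hS hS'
    exact hrr' ((Finset.mem_powersetCard.1 (Finset.mem_filter.1 hS).1).2.symm.trans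
      (Finset.mem_powersetCard.1 (Finset.mem_filter.1 hS').1).2)

end IsPermInvariantRandomSubset

/-! ### Face labels, edge words and subcomplexes spanned by faces. -/

/-- Both words are cut at the same places; this recovers the edge words from a face label. -/
theorem List.eq_of_flatMap_eq {E A : Type*} {W W' : E → List A}
    (hlen : ∀ e, (W e).length = (W' e).length) {l : List E} (h : l.flatMap W = l.flatMap W') :
    ∀ e ∈ l, W e = W' e := by
  induction l with
  | nil => simp
  | cons a l ih =>
    simp only [List.flatMap_cons] at h
    obtain ⟨h1, h2⟩ := List.append_inj h (hlen a)
    intro e he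
    rcases List.mem_cons.1 he with rfl | he
    · exact h1
    · exact ih h2 e he

theorem FreeGroup.invRev_flatMap {α E : Type*} (W : E → List (α × Bool)) (i : E → E)
    (hW : ∀ e, W (i e) = invRev (W e)) (l : List E) :
    (l.map i).reverse.flatMap W = invRev (l.flatMap W) := by
  induction l with
  | nil => rfl
  | cons a l ih =>
    rw [List.map_cons, List.reverse_cons, List.flatMap_append, ih, List.flatMap_cons,
      List.flatMap_nil, List.append_nil, hW, List.flatMap_cons, FreeGroup.invRev_append]

namespace TwoComplex

variable {V E F : Type*}

section Span

variable (Y : TwoComplex V E F)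

theorem inv_mem_bdry_finv {f : F} {e : E} (he : e ∈ Y.bdry f) : Y.inv e ∈ Y.bdry (Y.finv f) := by
  rw [Y.bdry_finv, List.mem_reverse]
  exact List.mem_map_of_mem he

/-- The edge `e`, in one of its orientations, lies on the boundary of a face in `T`. -/
def MeetsFace (T : Set F) (e : E) : Prop := ∃ f ∈ T, e ∈ Y.bdry f ∨ e ∈ Y.bdry (Y.finv f)

variable {Y} in
theorem MeetsFace.inv {T : Set F} {e : E} (h : Y.MeetsFace T e) : Y.MeetsFace T (Y.inv e) := by
  obtain ⟨f, hf, h | h⟩ := h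
  · exact ⟨f, hf, Or.inr (Y.inv_mem_bdry_finv h)⟩
  · refine ⟨f, hf, Or.inl ?_⟩
    have := Y.inv_mem_bdry_finv h
    rwa [Y.finv_finv] at this

/-- The sub-2-complex spanned by a set of faces. -/
def faceSpan (T : Set F) : Y.Sub where
  -- Vertices play no role in the counts, so all of them are kept.
  verts := Set.univ
  edges := {e | Y.MeetsFace T e}
  faces := {f | f ∈ T ∨ Y.finv f ∈ T}
  src_mem _ _ := trivial
  inv_mem _ he := he.inv
  finv_mem f hf := by
    rcases hf with hf | hf
    · right; rwa [Y.finv_finv]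
    · exact Or.inl hf
  bdry_mem f hf e he := by
    rcases hf with hf | hf
    · exact ⟨f, hf, Or.inl he⟩
    · exact ⟨_, hf, Or.inr (by rwa [Y.finv_finv])⟩

theorem numFaces_faceSpan (T : Set F) (hT : ∀ f ∈ T, Y.finv f ∉ T) :
    (Y.faceSpan T).numFaces = T.ncard := by
  have h : (fun f => s(f, Y.finv f)) '' (Y.faceSpan T).faces = (fun f => s(f, Y.finv f)) '' T := by
    refine Set.Subset.antisymm ?_ (Set.image_mono fun f hf => Or.inl hf)
    rintro _ ⟨f, hf | hf, rfl⟩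
    · exact ⟨f, hf, rfl⟩
    · exact ⟨_, hf, by simp only [Y.finv_finv]; exact Sym2.eq_swap⟩
  rw [Sub.numFaces, h]
  refine Set.InjOn.ncard_image fun f hf g hg hfg => ?_
  rcases Sym2.eq_iff.1 hfg with h | h
  · exact h.1
  · exact absurd (h.1 ▸ hf) (hT g hg)

-- Each edge of the span is a segment of an edge of `Y` meeting `T`; replacing it by its inverse if
-- necessary, that edge is positive.
open Classical in
theorem numEdges_faceSpan_subdivide_le [Fintype E] (n : E → ℕ) (hpos : ∀ e, 0 < n e)
    (hinv : ∀ e, n (Y.inv e) = n e) (T : Set F) (pos : E → Prop)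
    (hpos' : ∀ e, pos e ∨ pos (Y.inv e)) :
    ((Y.subdivide n hpos hinv).faceSpan T).numEdges ≤
      ∑ e ∈ Finset.univ.filter (fun e => pos e ∧ Y.MeetsFace T e), n e := by
  set s := Finset.univ.filter fun e => pos e ∧ Y.MeetsFace T e with hs
  let g : (Σ e : E, Fin (n e)) → Sym2 (SubdivEdge n) := fun q =>
    s(⟨(q.1, q.2), q.2.2⟩, (Y.subdivide n hpos hinv).inv ⟨(q.1, q.2), q.2.2⟩)
  have hmeets : ∀ p : SubdivEdge n, (Y.subdivide n hpos hinv).MeetsFace T p →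
      Y.MeetsFace T p.1.1 := by
    have key : ∀ (p : SubdivEdge n) (f : F), p ∈ (Y.subdivide n hpos hinv).bdry f →
        p.1.1 ∈ Y.bdry f := by
      intro p f hp
      obtain ⟨e, he, hp⟩ := List.mem_flatMap.1 hp
      obtain ⟨i, -, rfl⟩ := List.mem_map.1 hp
      exact he
    rintro p ⟨f, hf, h | h⟩
    · exact ⟨f, hf, Or.inl (key _ _ h)⟩
    · exact ⟨f, hf, Or.inr (key _ _ h)⟩
  have hsub : (fun p => s(p, (Y.subdivide n hpos hinv).inv p)) ''
      ((Y.subdivide n hpos hinv).faceSpan T).edges ⊆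
      ((s.sigma fun e => (Finset.univ : Finset (Fin (n e)))).image g : Set _) := by
    have key : ∀ p : SubdivEdge n, (Y.subdivide n hpos hinv).MeetsFace T p → pos p.1.1 →
        s(p, (Y.subdivide n hpos hinv).inv p) ∈
          ((s.sigma fun e => (Finset.univ : Finset (Fin (n e)))).image g) := by
      intro p hp hp'
      refine Finset.mem_image.2 ⟨⟨p.1.1, ⟨p.1.2, p.2⟩⟩, ?_, rfl⟩
      simpa [hs] using ⟨hp', hmeets p hp⟩
    rintro _ ⟨p, hp, rfl⟩
    rw [Finset.mem_coe]
    rcases hpos' p.1.1 with h | h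
    · exact key p hp h
    · have := key ((Y.subdivide n hpos hinv).inv p) (MeetsFace.inv hp) h
      rw [(Y.subdivide n hpos hinv).inv_inv, Sym2.eq_swap] at this
      exact this
  refine (Set.ncard_le_ncard hsub (Finset.finite_toSet _)).trans ?_
  rw [Set.ncard_coe_finset]
  refine Finset.card_image_le.trans ?_
  rw [Finset.card_sigma]
  simp

end Span

/-- Words of the right lengths along the edges of `Y` fill the subdivision of `Y`. -/
theorem fillable_subdivide_of_words (Y : TwoComplex V E F) (n : E → ℕ) (hpos : ∀ e, 0 < n e)
    (hinv : ∀ e, n (Y.inv e) = n e) {X : Type*} {R : Set (List (X × Bool))}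
    (W : E → List (X × Bool)) (hlen : ∀ e, (W e).length = n e)
    (hW : ∀ e, W (Y.inv e) = FreeGroup.invRev (W e))
    (hinj : Function.Injective fun f => (Y.bdry f).flatMap W)
    (hR : ∀ f, (Y.bdry f).flatMap W ∈ R ∨ FreeGroup.invRev ((Y.bdry f).flatMap W) ∈ R) :
    (Y.subdivide n hpos hinv).Fillable R := by
  have harc : ∀ e, (subdivArc n e).map
      (fun p : SubdivEdge n => (W p.1.1)[p.1.2]'((hlen p.1.1).symm ▸ p.2)) = W e := by
    intro e
    apply List.ext_getElem
    · simp [subdivArc, hlen]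
    · intro i h1 h2
      simp [subdivArc]
  refine ⟨⟨fun p => (W p.1.1)[p.1.2]'((hlen p.1.1).symm ▸ p.2), fun f => (Y.bdry f).flatMap W,
    ?_, hR, ?_, ?_⟩, ?_⟩
  · intro p
    have h2 := p.2
    have h3 := hlen p.1.1
    simp only [subdivide, hW, FreeGroup.invRev, List.getElem_reverse, List.getElem_map,
      List.length_map]
    have h4 : (W p.1.1).length - 1 - (n p.1.1 - 1 - p.1.2) = p.1.2 := by omega
    simp only [h4]
  · intro f
    simp only [subdivide]
    rw [Y.bdry_finv, FreeGroup.invRev_flatMap W Y.inv hW]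
  · intro f
    simp only [subdivide, List.map_flatMap, harc]
  -- Distinct faces have distinct labels, so no pair is reducible.
  · rintro ⟨f, f', hne, h, -⟩
    exact hne (hinj h)

section Words

variable {Y : TwoComplex V E F} {n : E → ℕ} {hpos : ∀ e, 0 < n e}
    {hinv : ∀ e, n (Y.inv e) = n e} {X : Type*} {R : Set (List (X × Bool))}

/-- The word read along an edge of `Y` in a filling of its subdivision. -/
def VanKampen.edgeWord (D : (Y.subdivide n hpos hinv).VanKampen R) (e : E) : List (X × Bool) :=
  (subdivArc n e).map D.edgeLabel

variable (D : (Y.subdivide n hpos hinv).VanKampen R)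

theorem VanKampen.length_edgeWord (e : E) : (D.edgeWord e).length = n e := by
  simp [edgeWord, subdivArc]

theorem VanKampen.edgeWord_inv (e : E) :
    D.edgeWord (Y.inv e) = FreeGroup.invRev (D.edgeWord e) := by
  rw [edgeWord, Y.subdivArc_inv n hinv (Y.subdivide n hpos hinv).inv (fun _ => rfl),
    FreeGroup.invRev, edgeWord, List.map_reverse, List.map_map, List.map_map]
  congr 2
  funext p
  exact D.edgeLabel_inv p

theorem VanKampen.faceLabel_eq (f : F) : D.faceLabel f = (Y.bdry f).flatMap D.edgeWord := by
  rw [← D.compatible f]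
  exact List.map_flatMap

/-- Two faces with the same boundary would carry the same label and share their first edge. This is
all that is used of the reducedness of the given filling. -/
theorem VanKampen.IsReduced.bdry_injective {D : (Y.subdivide n hpos hinv).VanKampen R}
    (hD : D.IsReduced) : Function.Injective Y.bdry := by
  intro f f' h
  by_contra hne
  have hb : (Y.subdivide n hpos hinv).bdry f = (Y.subdivide n hpos hinv).bdry f' := by
    simp only [subdivide, h]
  have hlen := List.length_pos_of_ne_nil ((Y.subdivide n hpos hinv).bdry_ne_nil f)
  refine hD ⟨f, f', hne, ?_, 0, ((Y.subdivide n hpos hinv).bdry f)[0], by simp, ?_⟩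
  · rw [← D.compatible, ← D.compatible, hb]
  · rw [← hb]; simp

end Words

end TwoComplex

/-! ### Varying the words of a given filling. -/

namespace FreeGroup

variable {α : Type*}

theorem isReduced_replicate_append {a c : α × Bool} (h : c.1 ≠ a.1) (i : ℕ) :
    IsReduced (List.replicate i a ++ [c]) := by
  refine List.isChain_append.2 ⟨isReduced_replicate i a, List.isChain_singleton c, ?_⟩
  intro x hx y hy hxy
  rw [(List.mem_replicate.1 (List.mem_of_getLast? hx)).2] at hxy
  rw [List.head?_singleton, Option.mem_some_iff] at hy
  exact absurd (hy ▸ hxy.symm) h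

theorem IsReduced.append_bridge {A B x : List (α × Bool)} {c d : α × Bool}
    (hA : IsReduced (A ++ [c])) (hx : IsReduced (c :: x ++ [d])) (hB : IsReduced ([d] ++ B)) :
    IsReduced (A ++ [c] ++ x ++ ([d] ++ B)) := by
  have h1 : IsReduced (A ++ [c] ++ (x ++ [d])) :=
    IsReduced.append_overlap hA (by simpa using hx) (by simp)
  have h2 : IsReduced (A ++ [c] ++ x ++ [d] ++ B) :=
    IsReduced.append_overlap (by simpa using h1) hB (by simp)
  simpa using h2

end FreeGroup

namespace TwoComplex

open FreeGroup

variable {V E F : Type*}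

open Classical in
/-- Extends a choice of words on the positive edges to all edges. -/
noncomputable def extendWords (Y : TwoComplex V E F) {X : Type*} (pos : E → Prop)
    (x : {e // pos e} → List (X × Bool)) (e : E) : List (X × Bool) :=
  -- The value `[]` never occurs when `pos` selects one orientation of each edge.
  if h : pos e then x ⟨e, h⟩ else if h' : pos (Y.inv e) then invRev (x ⟨Y.inv e, h'⟩) else []

theorem extendWords_of_pos (Y : TwoComplex V E F) {X : Type*} {pos : E → Prop}
    (x : {e // pos e} → List (X × Bool)) {e : E} (h : pos e) :
    Y.extendWords pos x e = x ⟨e, h⟩ := dif_pos h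

theorem extendWords_inv (Y : TwoComplex V E F) {X : Type*} {pos : E → Prop}
    (hpos : ∀ e, pos (Y.inv e) ↔ ¬ pos e) (x : {e // pos e} → List (X × Bool)) (e : E) :
    Y.extendWords pos x (Y.inv e) = invRev (Y.extendWords pos x e) := by
  by_cases h : pos e
  · have h' : ¬ pos (Y.inv e) := by rw [hpos]; simpa using h
    rw [extendWords_of_pos Y x h, extendWords, dif_neg h', dif_pos (by rwa [Y.inv_inv])]
    simp only [Y.inv_inv]
  · have h' : pos (Y.inv e) := (hpos e).2 h
    rw [extendWords_of_pos Y x h', extendWords, dif_neg h, dif_pos h', invRev_invRev]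

/-- A filling of a fine enough subdivision can be varied: with the first and last letters on the
edges of `Y` kept, most of the words on the edges may be chosen freely, while the faces keep pairwise
distinct cyclically reduced labels. -/
theorem exists_edge_words {m ℓ : ℕ} (hm : 2 ≤ m) (Y : TwoComplex V E F) (n : E → ℕ)
    (hn : ∀ e, 0 < n e) (hinv : ∀ e, n (Y.inv e) = n e)
    (D : (Y.subdivide n hn hinv).VanKampen (relatorBall m ℓ)) (hD : D.IsReduced)
    (idx : E → ℕ) (hidx : Function.Injective idx)
    (hlarge : ∀ e, idx e + idx (Y.inv e) + 5 ≤ n e)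
    (pos : E → Prop) (hpos : ∀ e, pos (Y.inv e) ↔ ¬ pos e) :
    ∃ (U : {e // pos e} → Finset (List (Fin m × Bool)))
      (W : ({e // pos e} → List (Fin m × Bool)) → E → List (Fin m × Bool)),
      (∀ e : {e // pos e},
        (2 * m - 1) ^ n e.1 ≤ (2 * m - 1) ^ (idx e.1 + idx (Y.inv e.1) + 5) * (U e).card) ∧
      (∀ x x' e, W x e.1 = W x' e.1 → x e = x' e) ∧
      ∀ x, (∀ e, x e ∈ U e) → (∀ e, (W x e).length = n e) ∧
        (∀ e, W x (Y.inv e) = invRev (W x e)) ∧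
        (∀ f, (Y.bdry f).flatMap (W x) ∈ relatorBall m ℓ) ∧
        Function.Injective fun f => (Y.bdry f).flatMap (W x) := by
  -- The first letter on `e` in the given filling. Keeping it for both orientations preserves all
  -- end letters, so no cancellation arises where edges meet.
  set a : E → Fin m × Bool := fun e => D.edgeLabel ⟨(e, 0), hn e⟩ with ha
  have hother : ∀ g : Fin m, ∃ g', g' ≠ g := by
    intro g
    have : Nontrivial (Fin m) := Fin.nontrivial_iff_two_le.2 hm
    exact exists_ne g
  choose other hother using hother
  set c : E → Fin m × Bool := fun e => (other (a e).1, true) with hc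
  have hca : ∀ e, (c e).1 ≠ (a e).1 := fun e => hother _
  set d : E → Fin m × Bool := fun e => ((c (Y.inv e)).1, !(c (Y.inv e)).2) with hd
  -- The exponent names the oriented edge; `c e`, from another generator, marks the end of the
  -- block.
  set pre : E → List (Fin m × Bool) := fun e => List.replicate (idx e + 1) (a e) ++ [c e] with hpre
  have hprelen : ∀ e, (pre e).length = idx e + 2 := fun e => by simp [hpre]
  set W : ({e // pos e} → List (Fin m × Bool)) → E → List (Fin m × Bool) := fun x e =>
    pre e ++ Y.extendWords pos x e ++ invRev (pre (Y.inv e)) with hW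
  have hinvpre : ∀ e, ∃ B, invRev (pre (Y.inv e)) = [d e] ++ B := fun e =>
    ⟨invRev (List.replicate (idx (Y.inv e) + 1) (a (Y.inv e))), by
      rw [hpre]; simp only [invRev_append]; rfl⟩
  have hprered : ∀ e, IsReduced (pre e) := fun e => isReduced_replicate_append (hca e) _
  have hWinv : ∀ x e, W x (Y.inv e) = invRev (W x e) := by
    intro x e
    simp only [hW, Y.extendWords_inv hpos, Y.inv_inv, invRev_append, invRev_invRev,
      List.append_assoc]
  have hWne : ∀ x e, W x e ≠ [] := fun x e => by simp [hW, hpre]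
  have hDne : ∀ e, D.edgeWord e ≠ [] := fun e h => by
    have h1 := D.length_edgeWord e
    have h2 := hn e
    rw [h] at h1
    simp at h1
    omega
  have hhead : ∀ x e, (W x e).head? = (D.edgeWord e).head? := by
    intro x e
    have h1 : (D.edgeWord e).head? = some (a e) := by
      rw [List.head?_eq_getElem?, List.getElem?_eq_getElem (by rw [D.length_edgeWord]; exact hn e)]
      simp [VanKampen.edgeWord, subdivArc, ha]
    rw [h1]
    simp [hW, hpre, List.replicate_succ]
  have hlast_of_head : ∀ w : List (Fin m × Bool),
      w.getLast? = (invRev w).head?.map fun b => (b.1, !b.2) := by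
    intro w
    rw [invRev, List.head?_reverse, List.getLast?_map, Option.map_map]
    simp [Function.comp_def]
  have hlast : ∀ x e, (W x e).getLast? = (D.edgeWord e).getLast? := by
    intro x e
    rw [hlast_of_head, hlast_of_head, ← hWinv, ← D.edgeWord_inv, hhead]
  -- The blocks at the two ends take `idx e + idx (Y.inv e) + 4` letters. The constant `5` also
  -- counts the letter lost in `pow_le_card_bridges`.
  refine ⟨fun e => bridges (d e.1) (n e.1 - (idx e.1 + idx (Y.inv e.1) + 4)) (c e.1), W,
    ?_, ?_, ?_⟩
  · intro e
    have h1 := hlarge e.1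
    have h2 := pow_le_card_bridges (α := Fin m) (by simpa using hm) (d e.1)
      (n e.1 - (idx e.1 + idx (Y.inv e.1) + 5)) (c e.1)
    rw [show n e.1 - (idx e.1 + idx (Y.inv e.1) + 5) + 1
      = n e.1 - (idx e.1 + idx (Y.inv e.1) + 4) by omega, Fintype.card_fin] at h2
    refine le_trans (le_of_eq ?_) (Nat.mul_le_mul_left _ h2)
    rw [← pow_add]
    congr 1
    omega
  · intro x x' e h
    simp only [hW, List.append_assoc] at h
    have := List.append_cancel_right (List.append_cancel_left h)
    rwa [Y.extendWords_of_pos x e.2, Y.extendWords_of_pos x' e.2] at this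
  · intro x hx
    have hlenpos : ∀ e, pos e → (W x e).length = n e := by
      intro e he
      have h1 := (mem_bridges.1 (hx ⟨e, he⟩)).1
      have h2 := hlarge e
      dsimp only at h1
      simp only [hW, List.length_append, invRev_length, hprelen, Y.extendWords_of_pos x he]
      omega
    have hredpos : ∀ e, pos e → IsReduced (W x e) := by
      intro e he
      have h1 := (mem_bridges.1 (hx ⟨e, he⟩)).2
      obtain ⟨B, hB⟩ := hinvpre e
      have h2 := (hprered (Y.inv e)).invRev
      simp only [hW, Y.extendWords_of_pos x he]
      rw [hB] at h2 ⊢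
      exact IsReduced.append_bridge (hprered e) h1 h2
    have hlen : ∀ e, (W x e).length = n e := by
      intro e
      by_cases he : pos e
      · exact hlenpos e he
      · have := hlenpos _ ((hpos e).2 he)
        rwa [hWinv, invRev_length, hinv] at this
    have hred : ∀ e, IsReduced (W x e) := by
      intro e
      by_cases he : pos e
      · exact hredpos e he
      · have := (hredpos _ ((hpos e).2 he)).invRev
        rwa [hWinv, invRev_invRev] at this
    refine ⟨hlen, hWinv x, fun f => ?_, ?_⟩
    · have hf : (Y.bdry f).flatMap D.edgeWord ∈ relatorBall m ℓ := by
        rw [← D.faceLabel_eq]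
        rcases D.faceLabel_mem f with h | h
        · exact h
        · have := h.1.invRev
          rw [invRev_invRev] at this
          exact ⟨this, by simpa using h.2⟩
      refine ⟨hf.1.flatMap_congr hDne (hWne x) (hhead x) (hlast x) hred, ?_⟩
      have := hf.2
      simpa only [List.length_flatMap, hlen, D.length_edgeWord] using this
    -- If one edge word is a prefix of another, their initial blocks are comparable, hence have
    -- equal exponents. Labels therefore determine boundary paths, which determine faces.
    · have hcode := List.flatMap_injective_of_prefixFree (W x) (hWne x) fun e e' h => by
        have h1 : pre e <+: W x e' := by
          refine List.IsPrefix.trans ?_ h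
          simp only [hW, List.append_assoc]
          exact List.prefix_append _ _
        have h2 : pre e' <+: W x e' := by
          simp only [hW, List.append_assoc]
          exact List.prefix_append _ _
        refine hidx ?_
        rcases List.prefix_or_prefix_of_prefix h1 h2 with h | h
        · exact List.eq_of_replicate_append_prefix (fun h => hca e (congrArg Prod.fst h)) h
        · exact (List.eq_of_replicate_append_prefix (fun h => hca e' (congrArg Prod.fst h)) h).symm
      exact fun f f' h => hD.bdry_injective (hcode h)

end TwoComplex

/-! ### The family of fillings and its overlaps. -/

namespace TwoComplex

open FreeGroup

variable {V E F : Type*}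

open Classical in
/-- The functions in a product of finite sets that are determined by their values outside `p` are
at most a proportion `1 / ∏ e with p e, #(U e)` of all. -/
theorem card_mul_prod_le_of_determined {ι β : Type*} [Fintype ι] [DecidableEq ι] (U : ι → Finset β) (p : ι → Prop)
    (A : Finset (ι → β)) (hA : A ⊆ Fintype.piFinset U)
    (hdet : ∀ x ∈ A, ∀ y ∈ A, ∀ i, p i → x i = y i) :
    A.card * ∏ i ∈ Finset.univ.filter p, (U i).card ≤ (Fintype.piFinset U).card := by
  have h1 : A.card ≤ (Fintype.piFinset fun i : {i // ¬ p i} => U i.1).card := by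
    refine Finset.card_le_card_of_injOn (fun x i => x i.1) ?_ ?_
    · intro x hx
      exact Fintype.mem_piFinset.2 fun i => Fintype.mem_piFinset.1 (hA hx) i.1
    · intro x hx y hy hxy
      funext i
      by_cases hi : p i
      · exact hdet x hx y hy i hi
      · exact congrFun hxy ⟨i, hi⟩
  have h2 : (Fintype.piFinset fun i : {i // ¬ p i} => U i.1).card
      = ∏ i ∈ Finset.univ.filter (fun i => ¬ p i), (U i).card := by
    rw [Fintype.card_piFinset]
    exact (Finset.prod_subtype _ (by simp) fun i => (U i).card).symm
  rw [Fintype.card_piFinset, ← Finset.prod_filter_mul_prod_filter_not Finset.univ p, mul_comm]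
  exact Nat.mul_le_mul_left _ (h1.trans h2.le)

open Classical in
/-- From one filling of a fine enough subdivision by cyclically reduced words one gets a large
family of fillings, with pairwise distinct relators on the geometric faces, in which the number of
pairs with common relators is controlled by the number of edges of the sub-2-complexes. -/
theorem exists_relator_family {m ℓ : ℕ} (hm : 2 ≤ m) (Y : TwoComplex V E F) [Fintype E] [Fintype F]
    (n : E → ℕ) (hn : ∀ e, 0 < n e) (hinv : ∀ e, n (Y.inv e) = n e)
    (D : (Y.subdivide n hn hinv).VanKampen (relatorBall m ℓ)) (hD : D.IsReduced)
    (idx : E → ℕ) (hidx : Function.Injective idx)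
    (hlarge : ∀ e, idx e + idx (Y.inv e) + 5 ≤ n e)
    (pos : E → Prop) (hpos : ∀ e, pos (Y.inv e) ↔ ¬ pos e)
    (fpos : F → Prop) (hfpos : ∀ f, fpos (Y.finv f) ↔ ¬ fpos f) :
    ∃ (Φ : Finset ({e // pos e} → List (Fin m × Bool)))
      (W : ({e // pos e} → List (Fin m × Bool)) → Finset (relatorBall m ℓ))
      (M : Finset {f // fpos f} × ({f // fpos f} → {f // fpos f}) →
        ({e // pos e} → List (Fin m × Bool)) → ({e // pos e} → List (Fin m × Bool)) → Prop),
      Φ.Nonempty ∧ (∀ φ ∈ Φ, (W φ).card = Fintype.card {f // fpos f}) ∧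
      (∀ φ ∈ Φ, ∀ S : Set (relatorBall m ℓ), (W φ : Set (relatorBall m ℓ)) ⊆ S →
        (Y.subdivide n hn hinv).Fillable (Subtype.val '' S)) ∧
      (∀ φ ∈ Φ, ∀ ψ ∈ Φ, (W φ ∩ W ψ).card ≠ 0 → ∃ j, j.1.card = (W φ ∩ W ψ).card ∧ M j φ ψ) ∧
      ∀ j, ∀ ψ ∈ Φ, ∃ Z : (Y.subdivide n hn hinv).Sub, Z.numFaces = j.1.card ∧
        (Φ.filter fun φ => M j φ ψ).card * (2 * m - 1) ^ Z.numEdges ≤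
          (2 * m - 1) ^ (∑ e, (idx e + idx (Y.inv e) + 5)) * Φ.card := by
  obtain ⟨U, w, hU, hwinj, hw⟩ :=
    exists_edge_words hm Y n hn hinv D hD idx hidx hlarge pos hpos
  set q := 2 * m - 1 with hq
  have hq0 : 0 < q := by omega
  set Φ := Fintype.piFinset U with hΦ
  have hmem : ∀ φ ∈ Φ, ∀ e, φ e ∈ U e := fun φ hφ => Fintype.mem_piFinset.1 hφ
  -- The default value is never taken for `φ ∈ Φ`. One relator per geometric face suffices, the
  -- opposite face receiving its inverse.
  let rel : ({e // pos e} → List (Fin m × Bool)) → {f // fpos f} → relatorBall m ℓ := fun φ f =>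
    if h : (Y.bdry f.1).flatMap (w φ) ∈ relatorBall m ℓ then ⟨_, h⟩
    else ⟨[], IsCyclicallyReduced.nil, Nat.zero_le _⟩
  have hrel : ∀ φ ∈ Φ, ∀ f, (rel φ f : List (Fin m × Bool)) = (Y.bdry f.1).flatMap (w φ) := by
    intro φ hφ f
    simp only [rel]
    rw [dif_pos ((hw φ (hmem φ hφ)).2.2.1 f.1)]
  have hrelinj : ∀ φ ∈ Φ, Function.Injective (rel φ) := by
    intro φ hφ f f' h
    have := congrArg Subtype.val h
    rw [hrel φ hφ, hrel φ hφ] at this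
    exact Subtype.ext ((hw φ (hmem φ hφ)).2.2.2 this)
  refine ⟨Φ, fun φ => Finset.univ.image (rel φ), fun j φ ψ => ∀ f ∈ j.1, rel φ f = rel ψ (j.2 f),
    ?_, ?_, ?_, ?_, ?_⟩
  · refine Fintype.piFinset_nonempty.2 fun e => Finset.card_pos.1 (Nat.pos_of_ne_zero fun h => ?_)
    have h1 := hU e
    rw [h, mul_zero] at h1
    exact absurd h1 (Nat.not_le.2 (Nat.pow_pos hq0))
  · intro φ hφ
    rw [Finset.card_image_of_injective _ (hrelinj φ hφ), Finset.card_univ]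
  · intro φ hφ S hS
    obtain ⟨h1, h2, h3, h4⟩ := hw φ (hmem φ hφ)
    have hin : ∀ f, fpos f → (Y.bdry f).flatMap (w φ) ∈ Subtype.val '' S := fun f hf =>
      ⟨rel φ ⟨f, hf⟩, hS (Finset.mem_coe.2 (Finset.mem_image_of_mem _ (Finset.mem_univ _))),
        hrel φ hφ _⟩
    refine Y.fillable_subdivide_of_words n hn hinv (w φ) h1 h2 h4 fun f => ?_
    by_cases hf : fpos f
    · exact Or.inl (hin f hf)
    · right
      have := hin _ ((hfpos f).2 hf)
      rwa [Y.bdry_finv, invRev_flatMap (w φ) Y.inv h2] at this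
  · intro φ hφ ψ hψ h0
    -- The overlap pattern: the faces whose `φ`-relator also occurs for `ψ`, and a matching `τ` to
    -- faces of `ψ`. The number of patterns does not depend on `ℓ`.
    set T : Finset {f // fpos f} :=
      Finset.univ.filter fun f => rel φ f ∈ Finset.univ.image (rel ψ) with hT
    have hex : ∀ f, ∃ g, f ∈ T → rel φ f = rel ψ g := by
      intro f
      by_cases hf : f ∈ T
      · obtain ⟨g, -, hg⟩ := Finset.mem_image.1 (Finset.mem_filter.1 hf).2
        exact ⟨g, fun _ => hg.symm⟩
      · exact ⟨f, fun h => absurd h hf⟩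
    choose τ hτ using hex
    refine ⟨(T, τ), ?_, fun f hf => hτ f hf⟩
    have : Finset.univ.image (rel φ) ∩ Finset.univ.image (rel ψ) = T.image (rel φ) := by
      ext r
      simp only [hT, Finset.mem_inter, Finset.mem_image, Finset.mem_univ, true_and,
        Finset.mem_filter]
      constructor
      · rintro ⟨⟨f, rfl⟩, h⟩
        exact ⟨f, h, rfl⟩
      · rintro ⟨f, h, rfl⟩
        exact ⟨⟨f, rfl⟩, h⟩
    rw [this, Finset.card_image_of_injective _ (hrelinj φ hφ)]
  · rintro ⟨T, τ⟩ ψ hψ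
    set T' : Set F := Subtype.val '' (T : Set {f // fpos f}) with hT'
    refine ⟨(Y.subdivide n hn hinv).faceSpan T', ?_, ?_⟩
    · rw [numFaces_faceSpan, hT', Set.ncard_image_of_injective _ Subtype.val_injective,
        Set.ncard_coe_finset]
      rintro _ ⟨f, -, rfl⟩ ⟨g, -, hg⟩
      exact (hfpos f.1).1 (show fpos (Y.finv f.1) from hg ▸ g.2) f.2
    · set A := Φ.filter fun φ => ∀ f ∈ T, rel φ f = rel ψ (τ f) with hA
      set p : {e // pos e} → Prop := fun e => Y.MeetsFace T' e.1 with hp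
      -- The labels on `T` are prescribed by `ψ` and `τ`. Cutting them at the fixed edge lengths
      -- prescribes the words on all edges meeting `T`.
      have hdet : ∀ x ∈ A, ∀ y ∈ A, ∀ e, p e → x e = y e := by
        intro x hx y hy e he
        obtain ⟨hx, hxψ⟩ := Finset.mem_filter.1 hx
        obtain ⟨hy, hyψ⟩ := Finset.mem_filter.1 hy
        obtain ⟨x1, x2, -, -⟩ := hw x (hmem x hx)
        obtain ⟨y1, y2, -, -⟩ := hw y (hmem y hy)
        obtain ⟨_, ⟨f, hf, rfl⟩, he⟩ := he
        have h1 : (Y.bdry f.1).flatMap (w x) = (Y.bdry f.1).flatMap (w y) := by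
          rw [← hrel x hx, ← hrel y hy, hxψ f hf, hyψ f hf]
        have h2 := List.eq_of_flatMap_eq (fun e => (x1 e).trans (y1 e).symm) h1
        refine hwinj x y e ?_
        rcases he with he | he
        · exact h2 _ he
        · have h3 := h2 _ (by have := Y.inv_mem_bdry_finv he; rwa [Y.finv_finv] at this)
          rw [x2, y2] at h3
          exact invRev_injective h3
      have hcount := card_mul_prod_le_of_determined U p A (Finset.filter_subset _ _) hdet
      have hedges := Y.numEdges_faceSpan_subdivide_le n hn hinv T' pos fun e => by
        rw [hpos]; exact Classical.em _
      have hmap : (Finset.univ.filter fun e => pos e ∧ Y.MeetsFace T' e)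
          = (Finset.univ.filter p).map (Function.Embedding.subtype pos) := by
        ext e
        simp [hp, and_comm]
      rw [hmap, Finset.sum_map] at hedges
      simp only [Function.Embedding.subtype_apply] at hedges
      -- The letters that are not free cost at most a constant power of `q` over all edges.
      have hprod : q ^ (∑ e ∈ Finset.univ.filter p, n e.1) ≤
          q ^ (∑ e, (idx e + idx (Y.inv e) + 5)) * ∏ e ∈ Finset.univ.filter p, (U e).card := by
        rw [← Finset.prod_pow_eq_pow_sum]
        refine (Finset.prod_le_prod' fun e _ => hU e).trans ?_
        rw [Finset.prod_mul_distrib, Finset.prod_pow_eq_pow_sum]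
        refine Nat.mul_le_mul_right _ (Nat.pow_le_pow_right hq0 ?_)
        have := Finset.sum_map (Finset.univ.filter p) (Function.Embedding.subtype pos)
          fun e => idx e + idx (Y.inv e) + 5
        simp only [Function.Embedding.subtype_apply] at this
        rw [← this]
        exact Finset.sum_le_sum_of_subset (Finset.subset_univ _)
      have arith : ∀ {a x y c u t : ℕ}, x ≤ y → y ≤ c * u → a * u ≤ t → a * x ≤ c * t := by
        intro a x y c u t h1 h2 h3
        calc a * x ≤ a * (c * u) := Nat.mul_le_mul_left _ (h1.trans h2)
          _ = c * (a * u) := by ring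
          _ ≤ c * t := Nat.mul_le_mul_left _ h3
      have hfin := arith (Nat.pow_le_pow_right hq0 hedges) hprod hcount
      convert hfin using 3
      ext φ
      simp only [hA, Finset.mem_filter]

end TwoComplex

/-! ### The estimate at a fixed scale. -/

namespace TwoComplex

variable {V E F : Type*}

theorem numEdges_faceSpan_singleton_le (Y : TwoComplex V E F) (f : F) :
    (Y.faceSpan {f}).numEdges ≤ (Y.bdry f).length := by
  classical
  have hsub : (fun e => s(e, Y.inv e)) '' (Y.faceSpan {f}).edges ⊆
      (((Y.bdry f).map fun e => s(e, Y.inv e)).toFinset : Set (Sym2 E)) := by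
    rintro _ ⟨e, ⟨f', rfl, he | he⟩, rfl⟩
    · simpa using ⟨e, he, Or.inl ⟨rfl, rfl⟩⟩
    · have h := Y.inv_mem_bdry_finv he
      rw [Y.finv_finv] at h
      simpa using ⟨Y.inv e, h, Or.inr ⟨rfl, Y.inv_inv e⟩⟩
  refine (Set.ncard_le_ncard hsub (Finset.finite_toSet _)).trans ?_
  rw [Set.ncard_coe_finset]
  exact (List.toFinset_card_le _).trans (by simp)

/-- A single face spans at most `ℓ` geometric edges, so the hypothesis on subcomplexes forces `1 - d
+ s ≤ 1`. -/
theorem le_density_of_fillable {m ℓ : ℕ} (hℓ : 0 < ℓ) (Y : TwoComplex V E F) (f : F)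
    (hfill : Y.Fillable (relatorBall m ℓ)) {d s : ℝ}
    (hineq : ∀ Z : Y.Sub, (1 - d + s) * (Z.numFaces : ℝ) * (ℓ : ℝ) ≤ (Z.numEdges : ℝ)) :
    s ≤ d := by
  obtain ⟨D, -⟩ := hfill
  have h1 := hineq (Y.faceSpan {f})
  rw [Y.numFaces_faceSpan {f} (by rintro _ rfl; exact Y.finv_ne _), Set.ncard_singleton] at h1
  have hlen : (Y.bdry f).length ≤ ℓ := by
    have h2 := congrArg List.length (D.compatible f)
    rw [List.length_map] at h2
    rcases D.faceLabel_mem f with h | h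
    · exact h2 ▸ h.2
    · have := h.2
      rw [FreeGroup.invRev_length] at this
      exact h2 ▸ this
  have h3 : ((Y.faceSpan {f}).numEdges : ℝ) ≤ ℓ := by
    exact_mod_cast (Y.numEdges_faceSpan_singleton_le f).trans hlen
  have h4 : (0 : ℝ) < ℓ := by exact_mod_cast hℓ
  have h5 : (1 - d + s) * ℓ ≤ 1 * ℓ := by
    rw [Nat.cast_one, mul_one] at h1
    linarith
  have := le_of_mul_le_mul_right h5 h4
  linarith

open Classical in
/-- A quantitative version at a fixed scale: most sets of `r` relators fill the subdivision. -/
theorem choose_le_card_fillable {m ℓ : ℕ} (hm : 2 ≤ m) (Y : TwoComplex V E F)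
    [Fintype E] [Fintype F] (n : E → ℕ) (hn : ∀ e, 0 < n e) (hinv : ∀ e, n (Y.inv e) = n e)
    (hfill : (Y.subdivide n hn hinv).Fillable (relatorBall m ℓ)) {d s : ℝ} (hs : 0 < s)
    (hineq : ∀ Z : (Y.subdivide n hn hinv).Sub,
      (1 - d + s) * (Z.numFaces : ℝ) * (ℓ : ℝ) ≤ (Z.numEdges : ℝ))
    (idx : E → ℕ) (hidx : Function.Injective idx)
    (hlarge : ∀ e, idx e + idx (Y.inv e) + 5 ≤ n e)
    (pos : E → Prop) (hpos : ∀ e, pos (Y.inv e) ↔ ¬ pos e)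
    (fpos : F → Prop) (hfpos : ∀ f, fpos (Y.finv f) ↔ ¬ fpos f)
    [Fintype (relatorBall m ℓ)] {r : ℕ} (h0 : 0 < r)
    (hr : r ≤ Fintype.card (relatorBall m ℓ)) (hk : 2 * Fintype.card {f // fpos f} ≤ r)
    (ht : 1 - d + s / 2 ≤ 1)
    (hbr : (Fintype.card (relatorBall m ℓ) : ℝ) / r
      ≤ ((2 * m - 1 : ℕ) : ℝ) ^ (((ℓ : ℝ) + 2) * (1 - d + s / 2))) :
    ((Fintype.card (relatorBall m ℓ)).choose r : ℝ) ≤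
      (1 + 4 ^ Fintype.card {f // fpos f} *
        (Fintype.card (Finset {f // fpos f} × ({f // fpos f} → {f // fpos f})) : ℝ) *
        ((2 * m - 1 : ℕ) : ℝ) ^ ((∑ e, (idx e + idx (Y.inv e) + 5) : ℕ) +
          2 * (Fintype.card {f // fpos f} : ℝ) - s / 2 * ℓ)) *
      ((Finset.powersetCard r Finset.univ).filter fun S : Finset (relatorBall m ℓ) =>
        (Y.subdivide n hn hinv).Fillable (Subtype.val '' (S : Set (relatorBall m ℓ)))).card := by
  obtain ⟨D, hD⟩ := hfill
  obtain ⟨Φ, W, M, hΦ, hW, hWfill, hM, hcount⟩ :=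
    exists_relator_family hm Y n hn hinv D hD idx hidx hlarge pos hpos fpos hfpos
  set q := 2 * m - 1 with hq
  set k := Fintype.card {f // fpos f} with hk'
  set C : ℕ := ∑ e, (idx e + idx (Y.inv e) + 5) with hC
  set η : ℝ := (q : ℝ) ^ ((C : ℝ) + 2 * (k : ℝ) - s / 2 * ℓ) with hη
  have hq1 : (1 : ℝ) ≤ q := by exact_mod_cast (by omega : 1 ≤ q)
  have hq0 : (0 : ℝ) < q := by linarith
  have hη0 : 0 < η := Real.rpow_pos_of_pos hq0 _
  -- The empty overlap is excluded: the gain `s / 2 * ℓ * i` needs `i ≥ 1`.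
  set J : Finset (Finset {f // fpos f} × ({f // fpos f} → {f // fpos f})) :=
    Finset.univ.filter fun j => j.1.card ≠ 0 with hJ
  have hmain := choose_le_card_filter_exists_subset Φ hΦ W hW h0 hk hr J M (fun j => j.1.card) η
    ?_ ?_
  · refine hmain.trans (mul_le_mul ?_ ?_ (Nat.cast_nonneg _) (by positivity))
    · gcongr
      exact Finset.card_le_univ J
    · rw [Nat.cast_le]
      refine Finset.card_le_card fun S hS => ?_
      obtain ⟨h1, φ, hφ, h2⟩ := Finset.mem_filter.1 hS
      exact Finset.mem_filter.2 ⟨h1, hWfill φ hφ S (Finset.coe_subset.2 h2)⟩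
  · intro φ hφ ψ hψ h
    obtain ⟨j, hj, hj'⟩ := hM φ hφ ψ hψ h
    exact ⟨j, Finset.mem_filter.2 ⟨Finset.mem_univ _, hj ▸ h⟩, hj, hj'⟩
  · intro j hj ψ hψ
    obtain ⟨Z, hZ, hcard⟩ := hcount j ψ hψ
    have hj0 := (Finset.mem_filter.1 hj).2
    have hjk : j.1.card ≤ k := Finset.card_le_univ _
    set i := j.1.card with hi
    set a := (Φ.filter fun φ => M j φ ψ).card with ha
    have hi1 : (1 : ℝ) ≤ i := by exact_mod_cast Nat.one_le_iff_ne_zero.2 hj0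
    have hik : (i : ℝ) ≤ k := by exact_mod_cast hjk
    have hedges := hineq Z
    rw [hZ] at hedges
    have hcard' : (a : ℝ) * (q : ℝ) ^ (Z.numEdges : ℝ) ≤ (q : ℝ) ^ (C : ℝ) * Φ.card := by
      rw [Real.rpow_natCast, Real.rpow_natCast]
      exact_mod_cast hcard
    have hpow : ((Fintype.card (relatorBall m ℓ) : ℝ) / r) ^ i
        ≤ (q : ℝ) ^ (((ℓ : ℝ) + 2) * (1 - d + s / 2) * i) := by
      rw [Real.rpow_mul hq0.le, Real.rpow_natCast]
      exact pow_le_pow_left₀ (by positivity) hbr i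
    -- The edge bound exceeds `(1 - d + s / 2) i ℓ` by `s / 2 * i * ℓ ≥ s / 2 * ℓ`. The two extra
    -- letters in `ℓ + 2` cost at most `2 i ≤ 2 k`.
    have hexp : ((ℓ : ℝ) + 2) * (1 - d + s / 2) * i + C
        ≤ ((C : ℝ) + 2 * (k : ℝ) - s / 2 * ℓ) + Z.numEdges := by
      have h1 : s / 2 * ℓ * 1 ≤ s / 2 * ℓ * i := by gcongr
      have h2 : (1 - d + s / 2) * i ≤ 1 * i := by gcongr
      nlinarith
    have hE : (0 : ℝ) < (q : ℝ) ^ (Z.numEdges : ℝ) := Real.rpow_pos_of_pos hq0 _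
    refine le_of_mul_le_mul_right ?_ hE
    calc (a : ℝ) * ((Fintype.card (relatorBall m ℓ) : ℝ) / r) ^ i * (q : ℝ) ^ (Z.numEdges : ℝ)
        = ((Fintype.card (relatorBall m ℓ) : ℝ) / r) ^ i *
            ((a : ℝ) * (q : ℝ) ^ (Z.numEdges : ℝ)) := by ring
      _ ≤ (q : ℝ) ^ (((ℓ : ℝ) + 2) * (1 - d + s / 2) * i) * ((q : ℝ) ^ (C : ℝ) * Φ.card) :=
          mul_le_mul hpow hcard' (by positivity) (by positivity)
      _ = (q : ℝ) ^ (((ℓ : ℝ) + 2) * (1 - d + s / 2) * i + C) * Φ.card := by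
          rw [Real.rpow_add hq0]; ring
      _ ≤ (q : ℝ) ^ (((C : ℝ) + 2 * (k : ℝ) - s / 2 * ℓ) + Z.numEdges) * Φ.card := by
          gcongr
      _ = η * Φ.card * (q : ℝ) ^ (Z.numEdges : ℝ) := by
          rw [Real.rpow_add hq0]; ring

end TwoComplex

/-! ### Letting `ℓ` tend to infinity. -/

theorem div_le_rpow_of_abs_logb_sub_le {b r N q d ε : ℝ} (hb : 1 < b) (hr : 1 ≤ r) (hrb : r ≤ b)
    (hq : 0 < q) (hbq : b ≤ q ^ N) (h : |Real.logb b r - d| ≤ ε) :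
    b ^ (d - ε) ≤ r ∧ b / r ≤ q ^ (N * (1 - d + ε)) := by
  have hb0 : 0 < b := by linarith
  have hr0 : 0 < r := by linarith
  have h1 : b ^ (d - ε) ≤ r :=
    (Real.le_logb_iff_rpow_le hb hr0).1 (by linarith [(abs_le.1 h).1])
  refine ⟨h1, ?_⟩
  -- A nonnegative exponent is needed to raise `b ≤ q ^ N` to it; it follows from `b ^ (d - ε) ≤ r ≤
  -- b`.
  have ht : 0 ≤ 1 - d + ε := by
    have h2 : b ^ (d - ε) ≤ b ^ (1 : ℝ) := by rw [Real.rpow_one]; linarith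
    have := (Real.rpow_le_rpow_left_iff hb).1 h2
    linarith
  calc b / r ≤ b / b ^ (d - ε) := by gcongr
    _ = b ^ (1 - d + ε) := by
        rw [show 1 - d + ε = 1 - (d - ε) by ring, Real.rpow_sub hb0 1, Real.rpow_one]
    _ ≤ (q ^ N) ^ (1 - d + ε) := by gcongr
    _ = _ := (Real.rpow_mul hq.le _ _).symm

theorem GeometricForm.eventually_le_floor {V E F : Type*} (Y : GeometricForm V E F) (c : E → ℕ) :
    ∀ᶠ ℓ : ℕ in atTop, ∀ e, c e ≤ max 1 ⌊Y.len e * ℓ⌋₊ := by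
  have := Y.finite_edges
  rw [eventually_all]
  intro e
  have h : Tendsto (fun ℓ : ℕ => ⌊Y.len e * ℓ⌋₊) atTop atTop :=
    tendsto_nat_floor_atTop.comp
      (tendsto_natCast_atTop_atTop.const_mul_atTop (Y.len_pos e))
  filter_upwards [h.eventually_ge_atTop (c e)] with ℓ hℓ
  exact hℓ.trans (le_max_right _ _)

/-- In each pair, the element with the smaller index under an injection into `ℕ` is positive. -/
theorem exists_orientation {A : Type*} [Countable A] (i : A → A) (hi : ∀ a, i (i a) = a)
    (hne : ∀ a, i a ≠ a) : ∃ pos : A → Prop, ∀ a, pos (i a) ↔ ¬ pos a := by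
  obtain ⟨idx, hidx⟩ := exists_injective_nat A
  refine ⟨fun a => idx a < idx (i a), fun a => ?_⟩
  have : idx (i a) ≠ idx a := fun h => hne a (hidx h)
  simp only [hi]
  omega

theorem mainTheorem5 {V E F : Type*} (Y : GeometricForm V E F) (m : ℕ) (hm : 2 ≤ m) (d s : ℝ)
    (hs : 0 < s) {Ω : ℕ → Type*} [∀ ℓ, MeasurableSpace (Ω ℓ)] (P : ∀ ℓ, Measure (Ω ℓ))
    [∀ ℓ, IsProbabilityMeasure (P ℓ)] (R : ∀ ℓ, Ω ℓ → Set (relatorBall m ℓ))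
    (hR : IsRandomGroupSequence m d P R)
    (hfill : ∀ᶠ ℓ in atTop, (Y.scaled ℓ).Fillable (relatorBall m ℓ))
    (hineq : ∀ᶠ ℓ in atTop, ∀ Z : (Y.scaled ℓ).Sub,
      (1 - d + s) * (Z.numFaces : ℝ) * (ℓ : ℝ) ≤ (Z.numEdges : ℝ)) :
    Tendsto (fun ℓ => P ℓ {ω | (Y.scaled ℓ).Fillable (Subtype.val '' R ℓ ω)}) atTop (𝓝 1) := by
  classical
  -- Without faces every condition involving relators is vacuous; otherwise a face is available to
  -- prove `s ≤ d`.
  rcases isEmpty_or_nonempty F with hF | ⟨⟨f₀⟩⟩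
  · refine tendsto_const_nhds.congr' ?_
    filter_upwards [hfill] with ℓ hℓ
    obtain ⟨D, -⟩ := hℓ
    rw [eq_comm, ← measure_univ (μ := P ℓ)]
    congr 1
    refine Set.eq_univ_of_forall fun ω => ⟨⟨D.edgeLabel, D.faceLabel, D.edgeLabel_inv,
      fun f => hF.elim f, fun f => hF.elim f, fun f => hF.elim f⟩, ?_⟩
    rintro ⟨f, -⟩
    exact hF.elim f
  have := Y.finite_edges
  have := Y.finite_faces
  have := Fintype.ofFinite E
  have := Fintype.ofFinite F
  obtain ⟨idx, hidx⟩ := exists_injective_nat E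
  obtain ⟨pos, hpos⟩ := exists_orientation Y.inv Y.inv_inv Y.inv_ne
  obtain ⟨fpos, hfpos⟩ := exists_orientation Y.finv Y.finv_finv Y.finv_ne
  have hds : s ≤ d := by
    obtain ⟨ℓ, h1, h2, h3⟩ := (hfill.and (hineq.and (eventually_gt_atTop 0))).exists
    exact TwoComplex.le_density_of_fillable h3 _ f₀ h1 h2
  set q : ℝ := ((2 * m - 1 : ℕ) : ℝ) with hq
  have hq1 : 1 < q := by
    rw [hq]
    exact_mod_cast (by omega : 1 < 2 * m - 1)
  set k := Fintype.card {f // fpos f} with hk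
  set K : ℝ := 4 ^ k *
    (Fintype.card (Finset {f // fpos f} × ({f // fpos f} → {f // fpos f})) : ℝ) with hK
  set C : ℝ := ((∑ e, (idx e + idx (Y.inv e) + 5) : ℕ) : ℝ) + 2 * (k : ℝ) with hC
  set c : ℕ → ℝ := fun ℓ => (1 + K * q ^ (C - s / 2 * ℓ))⁻¹ with hc
  have hden : ∀ ℓ : ℕ, 0 < 1 + K * q ^ (C - s / 2 * ℓ) := fun ℓ => by positivity
  have hclim : Tendsto c atTop (𝓝 1) := by
    have h1 : Tendsto (fun ℓ : ℕ => C - s / 2 * (ℓ : ℝ)) atTop atBot := by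
      have := (tendsto_natCast_atTop_atTop (R := ℝ)).const_mul_atTop (half_pos hs)
      simpa [sub_eq_add_neg] using
        tendsto_atBot_add_const_left atTop C (tendsto_neg_atTop_atBot.comp this)
    have h2 : Tendsto (fun ℓ : ℕ => q ^ (C - s / 2 * (ℓ : ℝ))) atTop (𝓝 0) :=
      (tendsto_rpow_atBot_of_base_gt_one q hq1).comp h1
    have h3 := ((h2.const_mul K).const_add 1).inv₀ (by simp)
    simpa using h3
  -- Half of `s` pays for the fluctuation of `|R_ℓ|`; the other half gives the exponential decay in
  -- `c`.
  have hGlim := hR.densable (s / 2) (half_pos hs)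
  set G : ∀ ℓ, Set (Ω ℓ) := fun ℓ => {ω | (R ℓ ω).Nonempty ∧
    |Real.logb ((relatorBall m ℓ).ncard : ℝ) ((R ℓ ω).ncard : ℝ) - d| ≤ s / 2} with hG
  have hlim : Tendsto (fun ℓ => ENNReal.ofReal (c ℓ) * P ℓ (G ℓ)) atTop (𝓝 1) := by
    have := ENNReal.Tendsto.mul (ENNReal.tendsto_ofReal hclim) (by simp) hGlim (by simp)
    simpa using this
  refine tendsto_of_tendsto_of_tendsto_of_le_of_le' hlim tendsto_const_nhds ?_
    (Eventually.of_forall fun ℓ => prob_le_one)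
  have hbig : ∀ᶠ ℓ : ℕ in atTop, (2 * k : ℝ) ≤ (ℓ : ℝ) ^ (s / 2) :=
    ((tendsto_rpow_atTop (half_pos hs)).comp
      tendsto_natCast_atTop_atTop).eventually_ge_atTop (2 * k : ℝ)
  filter_upwards [hfill, hineq, hbig, eventually_ge_atTop 2,
    Y.eventually_le_floor fun e => idx e + idx (Y.inv e) + 5] with ℓ hfillℓ hineqℓ hbigℓ hℓ2 hlarge
  have := (relatorBall_finite m ℓ).fintype
  have hcard : (relatorBall m ℓ).ncard = Fintype.card (relatorBall m ℓ) := by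
    rw [← Nat.card_coe_set_eq, Nat.card_eq_fintype_card]
  set b := Fintype.card (relatorBall m ℓ) with hb
  have hℓb : (ℓ : ℝ) ≤ b := by
    rw [← hcard]
    exact_mod_cast le_ncard_relatorBall hm ℓ
  have hbq : (b : ℝ) ≤ q ^ ((ℓ : ℝ) + 2) := by
    have h1 := ncard_relatorBall_le hm ℓ
    rw [hcard] at h1
    rw [hq, show (ℓ : ℝ) + 2 = ((ℓ + 2 : ℕ) : ℝ) by push_cast; ring, Real.rpow_natCast]
    exact_mod_cast h1
  have hℓ2' : (2 : ℝ) ≤ ℓ := by exact_mod_cast hℓ2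
  have key := (hR.permInvariant ℓ).mul_measure_le
    {S | (Y.scaled ℓ).Fillable (Subtype.val '' S)}
    {r | 0 < r ∧ |Real.logb (b : ℝ) (r : ℝ) - d| ≤ s / 2} (c ℓ) (inv_pos.2 (hden ℓ)).le ?_
  · refine le_trans (mul_le_mul_right (measure_mono ?_) _) key
    rintro ω ⟨h1, h2⟩
    rw [hcard] at h2
    exact ⟨(Set.ncard_pos (Set.toFinite _)).2 h1, h2⟩
  · rintro r ⟨hr0, hrd⟩ hrb
    obtain ⟨h1, h2⟩ := div_le_rpow_of_abs_logb_sub_le (N := (ℓ : ℝ) + 2) (by linarith)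
      (by exact_mod_cast hr0) (by exact_mod_cast hrb) (by linarith) hbq hrd
    -- Since `s ≤ d`, one has `r ≥ b ^ (d - s / 2) ≥ b ^ (s / 2) ≥ ℓ ^ (s / 2)`, which eventually
    -- exceeds `2 k`.
    have hkr : 2 * k ≤ r := by
      have h3 : (ℓ : ℝ) ^ (s / 2) ≤ (b : ℝ) ^ (s / 2) := by gcongr
      have h4 : (b : ℝ) ^ (s / 2) ≤ (b : ℝ) ^ (d - s / 2) :=
        Real.rpow_le_rpow_of_exponent_le (by linarith) (by linarith)
      exact_mod_cast hbigℓ.trans (h3.trans (h4.trans h1))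
    have h5 := TwoComplex.choose_le_card_fillable hm Y.toTwoComplex _ _ _ hfillℓ hs hineqℓ idx hidx
      hlarge pos hpos fpos hfpos hr0 hrb hkr (by linarith) h2
    rw [inv_mul_le_iff₀ (hden ℓ)]
    exact h5
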